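/- **Setting.** Nets of the symmetric interaction combinators are built from finitely many cells of types $\delta,\zeta$ (binary: one principal port and auxiliary ports $1,2$) and $\varepsilon$ (nullary: one principal port only), finitely many wires matching all the ports of cells and the free ports $1,\dots,n$ in pairs, and finitely many loops. They are taken up to renaming of non-free ports. If $C$ is a net with at least as many free ports as $\mu$ (a context), $C[\mu]$ is obtained by plugging free port $i$ of $\mu$ to free port $i$ of $C$. * One-step $\beta$-reduction is the contextual closure of the rules that rewrite two cells of symbols $\alpha,\beta$ whose principal ports are connected. If $\alpha=\beta$, the cells are erased and the auxiliary ports with the same number are joined by a wire. If $\alpha\ne\beta$, they are replaced by a $\beta$ cell on each auxiliary port of the $\alpha$ cell and an $\alpha$ cell on each auxiliary port of the $\beta$ cell, the $j$-th auxiliary port of the $i$-th new $\beta$ cell being joined to the $i$-th auxiliary port of the $j$-th new $\alpha$ cell. $\to^*$ is its reflexive-transitive closure. * The equation $\eta_0$ identifies a wire with two cells of the same binary symbol whose auxiliary ports with the same number are joined and whose principal ports are free. For $\alpha\neq\beta$, the equation $\eta_1$ identifies the tree with root $\alpha$ and a $\beta$ cell on each of its auxiliary ports with the tree with root $\beta$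 and an $\alpha$ cell on each of its auxiliary ports; the leaf reached through auxiliary port $i$ of an $\alpha$ cell and auxiliary port $j$ of a $\beta$ cell is the same free port in both. $\simeq_{\eta_0}$ and $\simeq_{\eta_1}$ are the least contextual equivalences containing these equations, and $\simeq_\eta\,=(\simeq_{\eta_0}\cup\simeq_{\eta_1})^+$. * A proper axiom is a (non-loop) wire neither end of which is a principal port. It is observable if its ends are leaves of trees of cells of the net (possibly reduced to a single wire) rooted, by the principal port of their root cell, at free ports $i$ and $j$. The address of a leaf is the pair $s=(a,b)$ of finite words over $\{\mathsf p,\mathsf q\}$ recording, from the root, which auxiliary port ($\mathsf p$ for $1$, $\mathsf q$ for $2$) is taken at the $\delta$ cells (in $a$) and at the $\zeta$ cells (in $b$). The address of the axiom is the unordered pair $\{(s,i),(t,j)\}$ of the addresses of its ends. Let $\mathrm{Obs}^*(\mu)$ be the set of the addresses of all observable axioms of all nets $\mu'$ such that $\mu\to^*\mu'$. $\mu$ is blind if $\mathrm{Obs}^*(\mu)=\emptyset$. * One-step $\varepsilon$-reduction is the contextual closure of the rule replacing a blind net with $n$ free ports, other than $\mathrm E_n$, by the net $\mathrm E_n$ made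 of $n$ $\varepsilon$ cells. $\mu\simeq_{\beta\varepsilon}\nu$ means that $\mu,\nu$ have a common reduct for the reflexive-transitive closure of the union of one-step $\beta$- and $\varepsilon$-reduction, and $\simeq_{\beta\varepsilon\eta}\,=(\simeq_{\beta\varepsilon}\cup\simeq_\eta)^+$. * The edifice of $\mu$ is the following set of unordered pairs of elements of $\{\mathsf p,\mathsf q\}^{\mathbb N}\times\{\mathsf p,\mathsf q\}^{\mathbb N}\times\mathbb N$, where concatenation of pairs of words is componentwise: $$\mathcal E(\mu)=\bigl\{\{(sw,i),(tw,j)\}\;:\;\{(s,i),(t,j)\}\in\mathrm{Obs}^*(\mu),\ w\in\{\mathsf p,\mathsf q\}^{\mathbb N}\times\{\mathsf p,\mathsf q\}^{\mathbb N}\bigr\}.$$ **Proposition.** For all nets $\mu,\nu$, if $\mu\simeq_{\beta\varepsilon\eta}\nu$ then $\mathcal E(\mu)=\mathcal E(\nu)$. In particular, $\mathcal E(\mu)=\mathcal E(\nu)$ whenever $\mu\to^*\nu$, or $\mu$ $\varepsilon$-reduces to $\nu$, or $\mu\simeq_{\eta_0}\nu$, or $\mu\simeq_{\eta_1}\nu$.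 -/

import Mathlib

/-! Symmetric interaction combinators, their `β`-, `ε`-reduction and `η`-equations, and the
edifice of a net. -/

namespace SymComb

/-- The three cell symbols. -/
inductive CellSymbol
  | delta
  | epsilon
  | zeta

/-- Number of auxiliary ports of a cell. -/
abbrev CellSymbol.arity : CellSymbol → ℕ
  | .delta => 2
  | .epsilon => 0
  | .zeta => 2

/-- The ports of a configuration with free ports `I`, cells `K`, and labelling `kind`.  The
auxiliary ports "number 1" and "number 2" of a binary cell are `aux c 0` and `aux c 1`. -/
inductive Port (I K : Type) (kind : K → CellSymbol) : Type
  | free (i : I)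
  | prin (c : K)
  | aux (c : K) (k : Fin (kind c).arity)

/-- A net with interface `I`: a finite family of cells, a perfect matching of the set of all ports
(free ports and ports of cells), whose two-element classes are the proper wires, and a finite number
of loops.  A net with `n` free ports is a `Net (Fin n)`. -/
structure Net (I : Type) where
  Cell : Type
  finite_cell : Finite Cell
  kind : Cell → CellSymbol
  wire : Port I Cell kind → Port I Cell kind
  wire_wire : ∀ p, wire (wire p) = p
  wire_ne : ∀ p, wire p ≠ p
  loops : ℕ

namespace Net

attribute [instance] Net.finite_cell

/-- The ports of a net. -/
abbrev Ports {I : Type} (μ : Net I) : Type := Port I μ.Cell μ.kind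

/-- The action on ports of a symbol-preserving map between cells; it fixes the free ports. -/
def _root_.SymComb.Port.map {I K L : Type} {kind : K → CellSymbol} {kind' : L → CellSymbol}
    (e : K → L) (h : ∀ c, kind' (e c) = kind c) : Port I K kind → Port I L kind'
  | .free i => .free i
  | .prin c => .prin (e c)
  | .aux c k => .aux (e c) (Fin.cast (congrArg CellSymbol.arity (h c).symm) k)

/-- `α`-equivalence: equality of nets up to the naming of cells and of non-free ports. -/
def AlphaEq {I : Type} (μ ν : Net I) : Prop :=
  ∃ (e : μ.Cell ≃ ν.Cell) (h : ∀ c, ν.kind (e c) = μ.kind c),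
    (∀ p : μ.Ports, ν.wire (p.map e h) = (μ.wire p).map e h) ∧ μ.loops = ν.loops

/-! ### Application of a context

A context for nets with interface `I` is a net `C : Net (I ⊕ J)`; its free port `inl i` is plugged to
the free port `i` of the net, and `J` is the interface of the result.  -/

section Plug

variable {I J : Type} (C : Net (I ⊕ J)) (μ : Net I)

/-- All the ports of `C` and `μ` put side by side. -/
abbrev Full : Type := C.Ports ⊕ μ.Ports

/-- Goes from one end of a wire of `C` or `μ` to the other end. -/
def across : Full C μ → Full C μ
  | .inl p => .inl (C.wire p)
  | .inr p => .inr (μ.wire p)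

/-- Exchanges the two free ports that are plugged together, and fixes all other ports. -/
def swap : Full C μ → Full C μ
  | .inl (.free (.inl i)) => .inr (.free i)
  | .inr (.free i) => .inl (.free (.inl i))
  | .inl (.free (.inr j)) => .inl (.free (.inr j))
  | .inl (.prin c) => .inl (.prin c)
  | .inl (.aux c k) => .inl (.aux c k)
  | .inr (.prin c) => .inr (.prin c)
  | .inr (.aux c k) => .inr (.aux c k)

/-- The ports that get plugged, and hence disappear in the application. -/
def Plugged (x : Full C μ) : Prop := swap C μ x ≠ x

/-- Crosses a plug, if there is one, and then the next wire. -/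
def next (x : Full C μ) : Full C μ := across C μ (swap C μ x)

/-- The symbols of the cells of the application. -/
abbrev plugKind : C.Cell ⊕ μ.Cell → CellSymbol := Sum.elim C.kind μ.kind

/-- The ports of the application, as ports of `C` or `μ`. -/
def toFull : Port J (C.Cell ⊕ μ.Cell) (plugKind C μ) → Full C μ
  | .free j => .inl (.free (.inr j))
  | .prin (.inl c) => .inl (.prin c)
  | .prin (.inr c) => .inr (.prin c)
  | .aux (.inl c) k => .inl (.aux c k)
  | .aux (.inr c) k => .inr (.aux c k)

variable {C μ}

theorem across_across (x : Full C μ) : across C μ (across C μ x) = x := by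
  rcases x with p | p <;> simp [across, wire_wire]

theorem across_ne (x : Full C μ) : across C μ x ≠ x := by
  rcases x with p | p <;> simp [across, wire_ne]

theorem swap_swap (x : Full C μ) : swap C μ (swap C μ x) = x := by
  rcases x with ((i | j) | c | ⟨c, k⟩) | (i | c | ⟨c, k⟩) <;> rfl

theorem toFull_injective : Function.Injective (toFull C μ) := by
  intro p q h
  rcases p with j | (c | c) | ⟨c | c, k⟩ <;> rcases q with j' | (c' | c') | ⟨c' | c', k'⟩ <;>
    cases h <;> rfl

theorem not_plugged_toFull (p : Port J (C.Cell ⊕ μ.Cell) (plugKind C μ)) :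
    ¬ Plugged C μ (toFull C μ p) := by
  rcases p with j | (c | c) | ⟨c | c, k⟩ <;> simp [Plugged, toFull, swap]

theorem exists_toFull {x : Full C μ} (hx : ¬ Plugged C μ x) : ∃ p, toFull C μ p = x := by
  rcases x with ((i | j) | c | ⟨c, k⟩) | (i | c | ⟨c, k⟩)
  · simp [Plugged, swap] at hx
  · exact ⟨.free j, rfl⟩
  · exact ⟨.prin (.inl c), rfl⟩
  · exact ⟨.aux (.inl c) k, rfl⟩
  · simp [Plugged, swap] at hx
  · exact ⟨.prin (.inr c), rfl⟩
  · exact ⟨.aux (.inr c) k, rfl⟩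

theorem swap_next (x : Full C μ) : across C μ (next C μ x) = swap C μ x := across_across _

theorem next_injective : Function.Injective (next C μ) := by
  intro x y h
  have h' := congrArg (across C μ) h
  rw [swap_next, swap_next] at h'
  have h'' := congrArg (swap C μ) h'
  rwa [swap_swap, swap_swap] at h''

instance finite_port {K : Type} [Finite I] [Finite K] (kind : K → CellSymbol) :
    Finite (Port I K kind) := by
  let f : Port I K kind → I ⊕ K ⊕ (Σ c : K, Fin (kind c).arity) := fun p =>
    match p with
    | .free i => .inl i
    | .prin c => .inr (.inl c)
    | .aux c k => .inr (.inr ⟨c, k⟩)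
  refine Finite.of_injective f ?_
  intro p q h
  rcases p with i | c | ⟨c, k⟩ <;> rcases q with i' | c' | ⟨c', k'⟩ <;> simp [f] at h
  · rw [h]
  · rw [h]
  · obtain ⟨rfl, h⟩ := h
    rw [eq_of_heq h]

theorem exists_return [Finite I] [Finite J] {x : Full C μ} (hx : ¬ Plugged C μ x) :
    ∃ k, 0 < k ∧ ¬ Plugged C μ ((next C μ)^[k] x) := by
  have h := (next_injective (C := C) (μ := μ)).mem_periodicPts x
  obtain ⟨k, hk, h⟩ := Function.mem_periodicPts.mp h
  refine ⟨k, hk, ?_⟩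
  rwa [h.eq]

/-- `EndOf x y`: starting from the unplugged port `x` and following wires and plugs, the first
unplugged port that is reached is `y`. -/
def EndOf (x y : Full C μ) : Prop :=
  ∃ k, 0 < k ∧ (next C μ)^[k] x = y ∧ ¬ Plugged C μ x ∧ ¬ Plugged C μ y ∧
    ∀ j, 0 < j → j < k → Plugged C μ ((next C μ)^[j] x)

theorem exists_endOf [Finite I] [Finite J] {x : Full C μ} (hx : ¬ Plugged C μ x) :
    ∃ y, EndOf x y := by
  classical
  have h := exists_return hx
  refine ⟨(next C μ)^[Nat.find h] x, Nat.find h, (Nat.find_spec h).1, rfl, hx,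
    (Nat.find_spec h).2, ?_⟩
  intro j hj hjk
  have := Nat.find_min h hjk
  by_contra hc
  exact this ⟨hj, hc⟩

theorem EndOf.unique {x y z : Full C μ} (h : EndOf x y) (h' : EndOf x z) : y = z := by
  obtain ⟨k, hk, rfl, -, hy, hm⟩ := h
  obtain ⟨k', hk', rfl, -, hz, hm'⟩ := h'
  rcases lt_trichotomy k k' with hlt | rfl | hlt
  · exact absurd (hm' k hk hlt) hy
  · rfl
  · exact absurd (hm k' hk' hlt) hz

theorem iterate_reverse {x : Full C μ} {k : ℕ} (hy : ¬ Plugged C μ ((next C μ)^[k] x)) :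
    ∀ j, j ≤ k → (next C μ)^[j] ((next C μ)^[k] x) = swap C μ ((next C μ)^[k - j] x) := by
  intro j
  induction j with
  | zero =>
    intro _
    simpa [Plugged] using (not_not.mp hy).symm
  | succ j ih =>
    intro hj
    obtain ⟨m, hm⟩ : ∃ m, k - j = m + 1 := ⟨k - j - 1, by omega⟩
    have hm' : k - (j + 1) = m := by omega
    rw [Function.iterate_succ_apply', ih (by omega), hm, hm', next, swap_swap,
      Function.iterate_succ_apply', swap_next]

theorem EndOf.symm {x y : Full C μ} (h : EndOf x y) : EndOf y x := by
  obtain ⟨k, hk, rfl, hx, hy, hm⟩ := h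
  have hr := iterate_reverse hy
  refine ⟨k, hk, ?_, hy, hx, ?_⟩
  · rw [hr k le_rfl, Nat.sub_self]
    exact not_not.mp hx
  · intro j hj hjk
    rw [hr j hjk.le]
    have := hm (k - j) (by omega) (by omega)
    intro hc
    rw [swap_swap] at hc
    exact this hc.symm

theorem EndOf.ne {x y : Full C μ} (h : EndOf x y) : y ≠ x := by
  obtain ⟨k, hk, rfl, hx, hy, hm⟩ := h
  intro hxy
  have hr := iterate_reverse hy
  rw [hxy] at hr
  rcases Nat.even_or_odd' k with ⟨m, rfl | rfl⟩
  · have h1 := hr m (by omega)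
    rw [show 2 * m - m = m by omega] at h1
    exact hm m (by omega) (by omega) h1.symm
  · have h1 := hr (m + 1) (by omega)
    rw [show 2 * m + 1 - (m + 1) = m by omega, Function.iterate_succ_apply'] at h1
    exact across_ne _ h1

theorem exists_end [Finite I] [Finite J] (p : Port J (C.Cell ⊕ μ.Cell) (plugKind C μ)) :
    ∃ q, EndOf (toFull C μ p) (toFull C μ q) := by
  obtain ⟨y, hy⟩ := exists_endOf (not_plugged_toFull p)
  obtain ⟨q, rfl⟩ := exists_toFull hy.symm.choose_spec.2.2.1
  exact ⟨q, hy⟩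

variable (C μ)

/-- Two ports of `C` or `μ` lie on the same line (open or closed) after plugging. -/
def SameLine : Setoid (Full C μ) :=
  Relation.EqvGen.setoid fun x y => y = across C μ x ∨ y = swap C μ x

/-- The number of loops created by plugging: the lines without any end, that is, all of whose ports
are plugged. -/
noncomputable def newLoops : ℕ :=
  Nat.card {l : Quotient (SameLine C μ) //
    ∀ x : Full C μ, Quotient.mk (SameLine C μ) x = l → Plugged C μ x}

/-- The application `C[μ]` of a context to a net. -/
noncomputable def plug [Finite I] [Finite J] : Net J where
  Cell := C.Cell ⊕ μ.Cell
  finite_cell := inferInstance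
  kind := plugKind C μ
  wire p := (exists_end p).choose
  wire_wire p := by
    have h1 := (exists_end p).choose_spec
    have h2 := (exists_end (exists_end p).choose).choose_spec
    exact toFull_injective (h2.unique h1.symm)
  wire_ne p h := (exists_end p).choose_spec.ne (congrArg (toFull C μ) h)
  loops := C.loops + μ.loops + newLoops C μ

end Plug

/-! ### The nets occurring in the rules -/

/-- Two cells with symbols `α` and `β` whose principal ports are connected; the auxiliary ports are
free. -/
def activePair (α β : CellSymbol) : Net (Fin α.arity ⊕ Fin β.arity) where
  Cell := Unit ⊕ Unit
  finite_cell := inferInstance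
  kind := Sum.elim (fun _ => α) (fun _ => β)
  wire
    | .free (.inl k) => .aux (.inl ()) k
    | .free (.inr k) => .aux (.inr ()) k
    | .prin (.inl _) => .prin (.inr ())
    | .prin (.inr _) => .prin (.inl ())
    | .aux (.inl _) k => .free (.inl k)
    | .aux (.inr _) k => .free (.inr k)
  wire_wire := by rintro ((k | k) | (_ | _) | ⟨_ | _, k⟩) <;> rfl
  wire_ne := by rintro ((k | k) | (_ | _) | ⟨_ | _, k⟩) <;> (intro h; cases h)
  loops := 0

/-- The wiring connecting the free port `inl k` to the free port `inr k`, for each `k`. -/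
def parallelWires (K : Type) : Net (K ⊕ K) where
  Cell := Empty
  finite_cell := inferInstance
  kind := Empty.elim
  wire
    | .free (.inl k) => .free (.inr k)
    | .free (.inr k) => .free (.inl k)
  wire_wire := by rintro ((k | k) | c | ⟨c, k⟩) <;> first | rfl | exact c.elim
  wire_ne := by rintro ((k | k) | c | ⟨c, k⟩) <;> first | exact c.elim | (intro h; cases h)
  loops := 0

/-- The right member of the commutation rule: a copy of the `β` cell on each auxiliary port of the
`α` cell, a copy of the `α` cell on each auxiliary port of the `β` cell, and the `j`-th auxiliary
port of the `i`-th copy of `β` connected to the `i`-th auxiliary port of the `j`-th copy of `α`. -/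
def commuted (α β : CellSymbol) : Net (Fin α.arity ⊕ Fin β.arity) where
  Cell := Fin α.arity ⊕ Fin β.arity
  finite_cell := inferInstance
  kind := Sum.elim (fun _ => β) (fun _ => α)
  wire
    | .free (.inl i) => .prin (.inl i)
    | .free (.inr j) => .prin (.inr j)
    | .prin (.inl i) => .free (.inl i)
    | .prin (.inr j) => .free (.inr j)
    | .aux (.inl i) j => .aux (.inr j) i
    | .aux (.inr j) i => .aux (.inl i) j
  wire_wire := by rintro ((k | k) | (_ | _) | ⟨_ | _, k⟩) <;> rfl
  wire_ne := by rintro ((k | k) | (_ | _) | ⟨_ | _, k⟩) <;> (intro h; cases h)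
  loops := 0

/-- The net consisting of `n` cells of type `ε`. -/
def epsNet (n : ℕ) : Net (Fin n) where
  Cell := Fin n
  finite_cell := inferInstance
  kind _ := .epsilon
  wire
    | .free i => .prin i
    | .prin i => .free i
    | .aux _ k => k.elim0
  wire_wire := by rintro (i | i | ⟨i, k⟩) <;> first | rfl | exact k.elim0
  wire_ne := by rintro (i | i | ⟨i, k⟩) <;> first | exact k.elim0 | (intro h; cases h)
  loops := 0

/-- The left member of the `η₀` equation: two `α` cells with free principal ports, whose
auxiliary ports with the same number are connected. -/
def etaZeroPair (α : CellSymbol) : Net (Unit ⊕ Unit) where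
  Cell := Unit ⊕ Unit
  finite_cell := inferInstance
  kind := Sum.elim (fun _ => α) (fun _ => α)
  wire
    | .free (.inl _) => .prin (.inl ())
    | .free (.inr _) => .prin (.inr ())
    | .prin (.inl _) => .free (.inl ())
    | .prin (.inr _) => .free (.inr ())
    | .aux (.inl _) k => .aux (.inr ()) k
    | .aux (.inr _) k => .aux (.inl ()) k
  wire_wire := by rintro ((_ | _) | (_ | _) | ⟨_ | _, k⟩) <;> rfl
  wire_ne := by rintro ((_ | _) | (_ | _) | ⟨_ | _, k⟩) <;> (intro h; cases h)
  loops := 0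

/-- The left member of the `η₁` equation: an `α` cell with a `β` cell on each auxiliary port.
The free port `inl ()` is the root, and `inr (i, j)` is the `j`-th auxiliary port of the `β` cell
on the `i`-th auxiliary port of the `α` cell. -/
def etaOneLeft (α β : CellSymbol) : Net (Unit ⊕ Fin α.arity × Fin β.arity) where
  Cell := Unit ⊕ Fin α.arity
  finite_cell := inferInstance
  kind := Sum.elim (fun _ => α) (fun _ => β)
  wire
    | .free (.inl _) => .prin (.inl ())
    | .prin (.inl _) => .free (.inl ())
    | .aux (.inl _) i => .prin (.inr i)
    | .prin (.inr i) => .aux (.inl ()) i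
    | .aux (.inr i) j => .free (.inr (i, j))
    | .free (.inr (i, j)) => .aux (.inr i) j
  wire_wire := by rintro ((_ | _) | (_ | _) | ⟨_ | _, k⟩) <;> rfl
  wire_ne := by rintro ((_ | _) | (_ | _) | ⟨_ | _, k⟩) <;> (intro h; cases h)
  loops := 0

/-- The right member of the `η₁` equation: a `β` cell with an `α` cell on each auxiliary port,
the free port `inr (i, j)` being the `i`-th auxiliary port of the `α` cell on the `j`-th auxiliary
port of the `β` cell. -/
def etaOneRight (α β : CellSymbol) : Net (Unit ⊕ Fin α.arity × Fin β.arity) where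
  Cell := Unit ⊕ Fin β.arity
  finite_cell := inferInstance
  kind := Sum.elim (fun _ => β) (fun _ => α)
  wire
    | .free (.inl _) => .prin (.inl ())
    | .prin (.inl _) => .free (.inl ())
    | .aux (.inl _) j => .prin (.inr j)
    | .prin (.inr j) => .aux (.inl ()) j
    | .aux (.inr j) i => .free (.inr (i, j))
    | .free (.inr (i, j)) => .aux (.inr j) i
  wire_wire := by rintro ((_ | _) | (_ | _) | ⟨_ | _, k⟩) <;> rfl
  wire_ne := by rintro ((_ | _) | (_ | _) | ⟨_ | _, k⟩) <;> (intro h; cases h)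
  loops := 0

/-! ### `β`-reduction -/

/-- The contextual closure of a family of relations between nets, nets being taken modulo
`α`-equivalence. -/
def ContextClosure (R : ∀ ⦃I : Type⦄, Net I → Net I → Prop) {J : Type} [Finite J]
    (μ ν : Net J) : Prop :=
  ∃ (I : Type) (_ : Finite I) (C : Net (I ⊕ J)) (a b : Net I),
    R a b ∧ AlphaEq μ (C.plug a) ∧ AlphaEq ν (C.plug b)

/-- The interaction rules: annihilation and commutation. -/
inductive BetaRule : ∀ ⦃I : Type⦄, Net I → Net I → Prop
  | annihilation (α : CellSymbol) :
      BetaRule (activePair α α) (parallelWires (Fin α.arity))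
  | commutation (α β : CellSymbol) (h : α ≠ β) :
      BetaRule (activePair α β) (commuted α β)

/-- One-step `β`-reduction. -/
def BetaStep {J : Type} [Finite J] (μ ν : Net J) : Prop := ContextClosure BetaRule μ ν

/-- `β`-reduction: the reflexive-transitive closure of one-step reduction, reflexivity being
understood modulo `α`-equivalence. -/
def BetaRed {J : Type} [Finite J] : Net J → Net J → Prop :=
  Relation.ReflTransGen fun μ ν => AlphaEq μ ν ∨ BetaStep μ ν

end Net

/-! ### Addresses and observable axioms -/

/-- Finite binary words; `false` and `true` stand for the letters `p` and `q`. -/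
abbrev Word : Type := List Bool

/-- Pairs of finite binary words. -/
abbrev BiWord : Type := Word × Word

/-- Componentwise concatenation. -/
def BiWord.append (s t : BiWord) : BiWord := (s.1 ++ t.1, s.2 ++ t.2)

/-- An address: an unordered pair of elements of `Word × Word × ℕ`. -/
abbrev Address : Type := Sym2 (BiWord × ℕ)

/-- Trees; an `ε` cell is a node without subtrees. -/
inductive Tree
  | wire : Tree
  | node (α : CellSymbol) (t : Fin α.arity → Tree) : Tree

/-- The contribution to the address of a leaf of the branching through the `k`-th auxiliary port of
a cell. -/
def branch : (α : CellSymbol) → Fin α.arity → BiWord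
  | .delta, k => ([decide (k.val = 1)], [])
  | .zeta, k => ([], [decide (k.val = 1)])
  | .epsilon, _ => ([], [])

namespace Net

/-- `μ` contains the tree, rooted at the given port (a free port, or an auxiliary port on which the
tree is grafted). -/
inductive HasTree {I : Type} (μ : Net I) : Tree → μ.Ports → Prop
  | wire (r : μ.Ports) : HasTree μ .wire r
  | node (r : μ.Ports) (c : μ.Cell) (t : Fin (μ.kind c).arity → Tree) :
      μ.wire r = .prin c → (∀ k, HasTree μ (t k) (.aux c k)) →
      HasTree μ (.node (μ.kind c) t) r

/-- `IsLeaf μ τ r s p`: the port `p` is a leaf, of address `s`, of the tree `τ` contained in `μ` with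
root `r`. -/
inductive IsLeaf {I : Type} (μ : Net I) : Tree → μ.Ports → BiWord → μ.Ports → Prop
  | wire (r : μ.Ports) : IsLeaf μ .wire r ([], []) r
  | node (r : μ.Ports) (c : μ.Cell) (t : Fin (μ.kind c).arity → Tree) (k : Fin (μ.kind c).arity)
      (s : BiWord) (p : μ.Ports) :
      μ.wire r = .prin c → IsLeaf μ (t k) (.aux c k) s p →
      IsLeaf μ (.node (μ.kind c) t) r ((branch (μ.kind c) k).append s) p

/-- The wire through `p` is a proper axiom: none of its ends is a principal port. -/
def IsProperAxiom {I : Type} (μ : Net I) (p : μ.Ports) : Prop :=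
  ∀ c, p ≠ .prin c ∧ μ.wire p ≠ .prin c

/-- The set of all addresses of observable axioms of `μ`.  The free ports are numbered from `1`. -/
def ObsPaths {n : ℕ} (μ : Net (Fin n)) : Set Address :=
  {x | ∃ (p : μ.Ports) (i j : Fin n) (τ τ' : Tree) (s t : BiWord),
    μ.IsProperAxiom p ∧
    μ.HasTree τ (.free i) ∧ μ.IsLeaf τ (.free i) s p ∧
    μ.HasTree τ' (.free j) ∧ μ.IsLeaf τ' (.free j) t (μ.wire p) ∧
    x = s((s, i.val + 1), (t, j.val + 1))}

/-- The set of all addresses of observable axioms of the `β`-reducts of `μ`. -/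
def AllObsPaths {n : ℕ} (μ : Net (Fin n)) : Set Address :=
  {x | ∃ μ', BetaRed μ μ' ∧ x ∈ μ'.ObsPaths}

/-- No observable axiom ever appears. -/
def Blind {n : ℕ} (μ : Net (Fin n)) : Prop := μ.AllObsPaths = ∅

/-! ### `ε`-reduction, `η`-equations and equivalences -/

/-- The `ε`-rule: a blind net is replaced with `ε` cells. -/
inductive EpsRule : ∀ ⦃I : Type⦄, Net I → Net I → Prop
  | erase {k : ℕ} (μ : Net (Fin k)) (h : μ.Blind) (h' : ¬ AlphaEq μ (epsNet k)) :
      EpsRule μ (epsNet k)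

/-- One-step `ε`-reduction. -/
def EpsStep {J : Type} [Finite J] (μ ν : Net J) : Prop := ContextClosure EpsRule μ ν

/-- `βε`-reduction. -/
def BetaEpsRed {J : Type} [Finite J] : Net J → Net J → Prop :=
  Relation.ReflTransGen fun μ ν => AlphaEq μ ν ∨ BetaStep μ ν ∨ EpsStep μ ν

/-- `βε`-equivalence. -/
def BetaEpsEq {J : Type} [Finite J] (μ ν : Net J) : Prop :=
  ∃ o, BetaEpsRed μ o ∧ BetaEpsRed ν o

/-- The `η₀` equation, for a binary symbol. -/
inductive EtaZeroRule : ∀ ⦃I : Type⦄, Net I → Net I → Prop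
  | mk (α : CellSymbol) (h : α ≠ .epsilon) : EtaZeroRule (etaZeroPair α) (parallelWires Unit)

/-- The `η₁` equation, for two different symbols. -/
inductive EtaOneRule : ∀ ⦃I : Type⦄, Net I → Net I → Prop
  | mk (α β : CellSymbol) (h : α ≠ β) : EtaOneRule (etaOneLeft α β) (etaOneRight α β)

/-- The reflexive, symmetric, transitive and contextual closure of a family of equations, nets being
taken modulo `α`-equivalence. -/
def EquationalClosure (R : ∀ ⦃I : Type⦄, Net I → Net I → Prop) {J : Type} [Finite J] :
    Net J → Net J → Prop :=
  Relation.ReflTransGen fun μ ν => AlphaEq μ ν ∨ ContextClosure R μ ν ∨ ContextClosure R ν μ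

/-- The relation generated by the `η₀` equation. -/
def EtaZeroEq {J : Type} [Finite J] (μ ν : Net J) : Prop := EquationalClosure EtaZeroRule μ ν

/-- The relation generated by the `η₁` equation. -/
def EtaOneEq {J : Type} [Finite J] (μ ν : Net J) : Prop := EquationalClosure EtaOneRule μ ν

/-- `η`-equivalence. -/
def EtaEq {J : Type} [Finite J] : Net J → Net J → Prop :=
  Relation.TransGen fun μ ν => EtaZeroEq μ ν ∨ EtaOneEq μ ν

/-- `βεη`-equivalence. -/
def BetaEpsEtaEq {J : Type} [Finite J] : Net J → Net J → Prop :=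
  Relation.TransGen fun μ ν => BetaEpsEq μ ν ∨ EtaEq μ ν

end Net

/-! ### Edifices -/

/-- Infinite binary words. -/
abbrev Cantor : Type := Stream' Bool

/-- Pillars: pairs of infinite words based at an integer. -/
abbrev Pillar : Type := (Cantor × Cantor) × ℕ

/-- Arches: unordered pairs of pillars. -/
abbrev Arch : Type := Sym2 Pillar

/-- Edifices: sets of arches. -/
abbrev Edifice : Type := Set Arch

/-- Componentwise concatenation of a pair of finite words and a pair of infinite words. -/
def BiWord.appendInf (s : BiWord) (w : Cantor × Cantor) : Cantor × Cantor :=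
  (s.1 ++ₛ w.1, s.2 ++ₛ w.2)

/-- The vault generated by an address. -/
def vault (x : Address) : Edifice :=
  {a | ∃ (s t : BiWord) (i j : ℕ) (w : Cantor × Cantor),
    x = s((s, i), (t, j)) ∧ a = s((s.appendInf w, i), (t.appendInf w, j))}

/-- The edifice of a net. -/
def Net.edifice {n : ℕ} (μ : Net (Fin n)) : Edifice := ⋃ x ∈ μ.AllObsPaths, vault x

end SymComb

/-! The edifice of a net turns out to be the input-output relation of a token machine, which the
rules preserve for elementary reasons.

A token carries two infinite stacks of letters, one for the `δ` cells and one for the `ζ` cells.  It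
enters a net by a free port and follows the wires; when it enters a binary cell by the principal
port, it pops a letter from the corresponding stack and leaves by the auxiliary port which that
letter denotes; when it enters by an auxiliary port, it pushes the letter of that port and leaves by
the principal port.  It is lost in `ε` cells (`Net.Run`, `Net.Exec`).

The relation `Exec` between what enters and what gets out is compositional: a run in `C[μ]`
alternates between runs in `C` and runs of `μ` (`run_plug_iff`), so that `C[μ]` and `C[ν]` have the
same `Exec` as soon as `μ` and `ν` do.  It is therefore enough to compare the two members of each
rule.  Popping undoes pushing (annihilation); the two stacks are independent (commutation and `η₁`);
popping a letter and pushing it back changes nothing, and is always possible on an infinite stack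
(`η₀`).

That `E(μ)` is `Exec` with the two ends unordered (`mem_edifice_iff`) is proved as follows.  A token
that crosses an observable axiom goes down a tree, along the axiom, and up another tree, so that it
changes `sw` into `tw`; by invariance under `β`-reduction, this gives one inclusion.  Conversely, a
run that never goes down after having gone up is of this form (`Run.exists_obsPath`).  In any other
run, a move up is followed at once by a move down, and the two cells involved form an active pair;
firing it yields a run with the same ends in which the number of inversions, i.e. of pairs of a move
up and a later move down, is strictly smaller (`Run.exists_betaStep`).  By induction, each run
becomes an observable axiom in some reduct (`Run.exists_allObsPath`).

In particular a blind net has no run at all, like a net made of `ε` cells, whence the case of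
`ε`-reduction. -/

namespace SymComb

/-! ### The token machine -/

/-- The way in which a token crosses a cell: `down` from the principal port to an auxiliary port,
`up` from an auxiliary port to the principal port. -/
inductive Dir
  | down
  | up

/-- The record of a run: the direction of each crossing of a cell, and the mark of that cell. -/
abbrev Itinerary : Type := List (Dir × Bool)

namespace Net

/-- `Run μ m p x l j y`: a token that leaves the port `p` along its wire, with the pair of stacks
`x`, gets out of `μ` at the free port `j` with the pair of stacks `y`.  Going down through a binary
cell pops a letter, which selects the auxiliary port; going up pushes the letter of the auxiliary
port.  The `δ` cells act on the first stack and the `ζ` cells on the second one, and a token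
reaching an `ε` cell is lost.  The itinerary `l` records the crossings, `m` being a marking of the
cells. -/
inductive Run {I : Type} (μ : Net I) (m : μ.Cell → Bool) :
    μ.Ports → Cantor × Cantor → Itinerary → I → Cantor × Cantor → Prop
  | exit {p j x} : μ.wire p = .free j → Run μ m p x [] j x
  | down {p c k x l j y} : μ.wire p = .prin c → Run μ m (.aux c k) x l j y →
      Run μ m p ((branch (μ.kind c) k).appendInf x) ((.down, m c) :: l) j y
  | up {p c k x l j y} : μ.wire p = .aux c k →
      Run μ m (.prin c) ((branch (μ.kind c) k).appendInf x) l j y →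
      Run μ m p x ((.up, m c) :: l) j y

/-- The input-output relation of the token machine. -/
def Exec {I : Type} (μ : Net I) (i : I) (x : Cantor × Cantor) (j : I) (y : Cantor × Cantor) :
    Prop :=
  ∃ l, Run μ (fun _ => false) (.free i) x l j y

/-- The marking plays no role in the run itself. -/
theorem Run.remark {I : Type} {μ : Net I} {m : μ.Cell → Bool} {p : μ.Ports} {x y : Cantor × Cantor}
    {l : Itinerary} {j : I} (h : Run μ m p x l j y) (m' : μ.Cell → Bool) :
    ∃ l' : Itinerary, l'.map Prod.fst = l.map Prod.fst ∧ Run μ m' p x l' j y := by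
  induction h with
  | exit h => exact ⟨[], rfl, .exit h⟩
  | down h _ ih =>
    obtain ⟨l', e, r⟩ := ih
    exact ⟨_ :: l', by simp [e], .down h r⟩
  | up h _ ih =>
    obtain ⟨l', e, r⟩ := ih
    exact ⟨_ :: l', by simp [e], .up h r⟩

theorem exec_iff {I : Type} {μ : Net I} (m : μ.Cell → Bool) {i j : I} {x y : Cantor × Cantor} :
    μ.Exec i x j y ↔ ∃ l, Run μ m (.free i) x l j y :=
  ⟨fun ⟨_, h⟩ => (h.remark m).imp fun _ h => h.2, fun ⟨_, h⟩ => (h.remark _).imp fun _ h => h.2⟩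

/-! ### Invariance under renaming -/

theorem branch_cast {α β : CellSymbol} (h : β = α) (k : Fin α.arity) :
    branch β (Fin.cast (congrArg CellSymbol.arity h.symm) k) = branch α k := by
  subst h; rfl

theorem Run.map {I : Type} {μ ν : Net I} {e : μ.Cell → ν.Cell}
    {h : ∀ c, ν.kind (e c) = μ.kind c}
    (hw : ∀ p : μ.Ports, ν.wire (p.map e h) = (μ.wire p).map e h) {m : ν.Cell → Bool}
    {p : μ.Ports} {x y : Cantor × Cantor} {l : Itinerary} {j : I}
    (r : Run μ (m ∘ e) p x l j y) : Run ν m (p.map e h) x l j y := by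
  induction r with
  | exit h' => exact .exit (by rw [hw, h']; rfl)
  | @down p c k x l j y h' _ ih =>
    rw [← branch_cast (h c) k]
    exact Run.down (by rw [hw, h']; rfl) ih
  | @up p c k x l j y h' _ ih =>
    rw [← branch_cast (h c) k] at ih
    exact Run.up (by rw [hw, h']; rfl) ih

theorem Port.map_map_symm {I K L : Type} {kind : K → CellSymbol} {kind' : L → CellSymbol}
    (e : K ≃ L) (h : ∀ c, kind' (e c) = kind c) (h' : ∀ d, kind (e.symm d) = kind' d)
    (q : Port I L kind') : (q.map e.symm h').map e h = q := by
  rcases q with i | c | ⟨c, k⟩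
  · rfl
  · simp [Port.map]
  · have key : ∀ (d : L) (hd : d = c) (e' : (kind' c).arity = (kind' d).arity),
        (Port.aux d (Fin.cast e' k) : Port I L kind') = .aux c k := by
      intro d hd e'; subst hd; rfl
    exact key _ (e.apply_symm_apply c) (by rw [e.apply_symm_apply])

theorem Port.map_injective {I K L : Type} {kind : K → CellSymbol} {kind' : L → CellSymbol}
    (e : K ≃ L) (h : ∀ c, kind' (e c) = kind c) :
    Function.Injective (Port.map (I := I) e h) := by
  intro p q hpq
  have h' : ∀ d, kind (e.symm d) = kind' d := fun d => by rw [← h, e.apply_symm_apply]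
  have := congrArg (fun r => Port.map e.symm h' r) hpq
  have key := Port.map_map_symm (I := I) e.symm h' h
  simp only [Equiv.symm_symm] at key
  rwa [key, key] at this

theorem wire_map_symm {I : Type} {μ ν : Net I} (e : μ.Cell ≃ ν.Cell)
    (h : ∀ c, ν.kind (e c) = μ.kind c) (h' : ∀ d, μ.kind (e.symm d) = ν.kind d)
    (hw : ∀ p : μ.Ports, ν.wire (p.map e h) = (μ.wire p).map e h) (q : ν.Ports) :
    μ.wire (q.map e.symm h') = (ν.wire q).map e.symm h' := by
  apply Port.map_injective e h
  rw [← hw, Port.map_map_symm, Port.map_map_symm]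

theorem AlphaEq.symm {I : Type} {μ ν : Net I} (h : AlphaEq μ ν) : AlphaEq ν μ := by
  obtain ⟨e, h, hw, hl⟩ := h
  have h' : ∀ d, μ.kind (e.symm d) = ν.kind d := fun d => by rw [← h, e.apply_symm_apply]
  exact ⟨e.symm, h', wire_map_symm e h h' hw, hl.symm⟩

theorem AlphaEq.refl {I : Type} (μ : Net I) : AlphaEq μ μ :=
  have key : ∀ q : μ.Ports, q.map (Equiv.refl μ.Cell) (fun _ => rfl) = q := by
    rintro (_ | _ | _) <;> rfl
  ⟨Equiv.refl _, fun _ => rfl, fun p => (congrArg μ.wire (key p)).trans (key _).symm, rfl⟩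

theorem AlphaEq.exec_le {I : Type} {μ ν : Net I} (h : AlphaEq μ ν) {i x j y}
    (hx : μ.Exec i x j y) : ν.Exec i x j y := by
  obtain ⟨e, h, hw, -⟩ := h
  obtain ⟨l, r⟩ := hx
  exact ⟨l, Run.map (m := fun _ => false) (e := e) hw r⟩

theorem AlphaEq.exec_eq {I : Type} {μ ν : Net I} (h : AlphaEq μ ν) : μ.Exec = ν.Exec := by
  ext i x j y
  exact ⟨h.exec_le, h.symm.exec_le⟩

/-! ### Runs in the application of a context -/

section Plug

variable {I J : Type} (C : Net (I ⊕ J)) (μ : Net I)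

/-- The token machine on `C` and `μ` put side by side, a token reaching a plugged port hopping
silently to the port it is plugged to. -/
inductive FullRun (m : C.Cell ⊕ μ.Cell → Bool) :
    Full C μ → Cantor × Cantor → Itinerary → J → Cantor × Cantor → Prop
  | exit {u j x} : across C μ u = toFull C μ (.free j) → FullRun m u x [] j x
  | hop {u x l j y} : Plugged C μ (across C μ u) → FullRun m (swap C μ (across C μ u)) x l j y →
      FullRun m u x l j y
  | down {u c k x l j y} : across C μ u = toFull C μ (.prin c) →
      FullRun m (toFull C μ (.aux c k)) x l j y →
      FullRun m u ((branch (plugKind C μ c) k).appendInf x) ((.down, m c) :: l) j y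
  | up {u c k x l j y} : across C μ u = toFull C μ (.aux c k) →
      FullRun m (toFull C μ (.prin c)) ((branch (plugKind C μ c) k).appendInf x) l j y →
      FullRun m u x ((.up, m c) :: l) j y

variable {C μ}

theorem fullRun_hop {m : C.Cell ⊕ μ.Cell → Bool} {w : Full C μ} {x y l j} (hw : Plugged C μ w) :
    FullRun C μ m (across C μ w) x l j y ↔ FullRun C μ m (swap C μ w) x l j y := by
  constructor
  · intro h
    cases h with
    | exit h => rw [across_across] at h; exact absurd hw (h ▸ not_plugged_toFull _)
    | hop _ h => rwa [across_across] at h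
    | down h => rw [across_across] at h; exact absurd hw (h ▸ not_plugged_toFull _)
    | up h => rw [across_across] at h; exact absurd hw (h ▸ not_plugged_toFull _)
  · intro h
    exact .hop (by rwa [across_across]) (by rwa [across_across])

/-- The silent hops of a token follow the lines that define the wires of the application. -/
theorem EndOf.fullRun_iff {m : C.Cell ⊕ μ.Cell → Bool} {u v : Full C μ} (h : EndOf u v) {x y l j} :
    FullRun C μ m u x l j y ↔ FullRun C μ m (across C μ v) x l j y := by
  obtain ⟨k, hk, rfl, hu, -, hm⟩ := h
  have key : ∀ i, i < k →
      (FullRun C μ m u x l j y ↔ FullRun C μ m (across C μ ((next C μ)^[i + 1] u)) x l j y) := by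
    intro i
    induction i with
    | zero =>
      intro _
      rw [Function.iterate_succ_apply', swap_next, Function.iterate_zero, id, not_not.mp hu]
    | succ i ih =>
      intro hi
      rw [ih (by omega), Function.iterate_succ_apply' _ (i + 1), swap_next]
      exact fullRun_hop (hm (i + 1) (by omega) hi)
  obtain ⟨k, rfl⟩ : ∃ i, k = i + 1 := ⟨k - 1, by omega⟩
  exact key k (by omega)

theorem plug_endOf [Finite I] [Finite J] (p : (C.plug μ).Ports) :
    EndOf (toFull C μ p) (toFull C μ ((C.plug μ).wire p)) :=
  (exists_end (C := C) (μ := μ) p).choose_spec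

theorem Run.fullRun [Finite I] [Finite J] {m : C.Cell ⊕ μ.Cell → Bool} {p : (C.plug μ).Ports}
    {x y l j} (h : Run (C.plug μ) m p x l j y) : FullRun C μ m (toFull C μ p) x l j y := by
  induction h with
  | @exit p j x h =>
    have := plug_endOf p
    rw [h] at this
    exact this.fullRun_iff.mpr (.exit (across_across _))
  | @down p c k x l j y h _ ih =>
    have := plug_endOf p
    rw [h] at this
    exact this.fullRun_iff.mpr (.down (across_across _) ih)
  | @up p c k x l j y h _ ih =>
    have := plug_endOf p
    rw [h] at this
    exact this.fullRun_iff.mpr (.up (across_across _) ih)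

theorem FullRun.run [Finite I] [Finite J] {m : C.Cell ⊕ μ.Cell → Bool} {l : Itinerary} :
    ∀ {p : (C.plug μ).Ports} {x y j},
      FullRun C μ m (toFull C μ p) x l j y → Run (C.plug μ) m p x l j y := by
  induction l with
  | nil =>
    intro p x y j h
    rw [(plug_endOf p).fullRun_iff] at h
    cases h with
    | exit h => rw [across_across] at h; exact .exit (toFull_injective h)
    | hop h => rw [across_across] at h; exact absurd h (not_plugged_toFull _)
  | cons a l ih =>
    intro p x y j h
    rw [(plug_endOf p).fullRun_iff] at h
    cases h with
    | hop h => rw [across_across] at h; exact absurd h (not_plugged_toFull _)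
    | down h h' =>
      rw [across_across] at h
      exact Run.down (μ := C.plug μ) (toFull_injective h) (ih h')
    | up h h' =>
      rw [across_across] at h
      exact Run.up (μ := C.plug μ) (toFull_injective h) (ih h')

end Plug

/-- The token machine of a context `C` in which a token reaching a plugged free port is handled by
an oracle `R`, which stands for the net in the hole. -/
inductive OracleRun {I J : Type} (C : Net (I ⊕ J)) (m : C.Cell → Bool)
    (R : I → Cantor × Cantor → Itinerary → I → Cantor × Cantor → Prop) :
    C.Ports → Cantor × Cantor → Itinerary → J → Cantor × Cantor → Prop
  | exit {p j x} : C.wire p = .free (.inr j) → OracleRun C m R p x [] j x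
  | call {p i x l i' x' l' j y} : C.wire p = .free (.inl i) → R i x l i' x' →
      OracleRun C m R (.free (.inl i')) x' l' j y → OracleRun C m R p x (l ++ l') j y
  | down {p c k x l j y} : C.wire p = .prin c → OracleRun C m R (.aux c k) x l j y →
      OracleRun C m R p ((branch (C.kind c) k).appendInf x) ((.down, m c) :: l) j y
  | up {p c k x l j y} : C.wire p = .aux c k →
      OracleRun C m R (.prin c) ((branch (C.kind c) k).appendInf x) l j y →
      OracleRun C m R p x ((.up, m c) :: l) j y

section Oracle

variable {I J : Type} {C : Net (I ⊕ J)} {μ : Net I}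

/-- A run on `C` and `μ` side by side that starts in `C` is a run of `C` with calls to `μ`; if it
starts in `μ`, a run of `μ` comes before. -/
theorem FullRun.oracleRun {mC : C.Cell → Bool} {mμ : μ.Cell → Bool} {u : Full C μ} {x y l j}
    (h : FullRun C μ (Sum.elim mC mμ) u x l j y) :
    (∀ p, u = .inl p → OracleRun C mC (fun i => Run μ mμ (.free i)) p x l j y) ∧
    (∀ q, u = .inr q → ∃ l₁ l₂ i x', l = l₁ ++ l₂ ∧ Run μ mμ q x l₁ i x' ∧
      OracleRun C mC (fun i => Run μ mμ (.free i)) (.free (.inl i)) x' l₂ j y) := by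
  induction h with
  | @exit u j x h =>
    constructor
    · rintro p rfl
      exact .exit (Sum.inl_injective h)
    · rintro q rfl
      cases h
  | @hop u x l j y h _ ih =>
    constructor
    · rintro p rfl
      change Plugged C μ (.inl (C.wire p)) at h
      change _ ∧ ∀ q, swap C μ (.inl (C.wire p)) = _ → _ at ih
      generalize hq : C.wire p = q at h ih
      rcases q with (i | i) | c | ⟨c, k⟩
      · obtain ⟨l₁, l₂, i', x', rfl, h₁, h₂⟩ := ih.2 _ rfl
        exact .call hq h₁ h₂
      all_goals exact absurd rfl h
    · rintro q rfl
      change Plugged C μ (.inr (μ.wire q)) at h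
      change (∀ p, swap C μ (.inr (μ.wire q)) = _ → _) ∧ _ at ih
      generalize hq : μ.wire q = p at h ih
      rcases p with i | c | ⟨c, k⟩
      · exact ⟨[], l, i, x, rfl, .exit hq, ih.1 _ rfl⟩
      all_goals exact absurd rfl h
  | @down u c k x l j y h _ ih =>
    rcases c with c | c
    · constructor
      · rintro p rfl
        exact .down (Sum.inl_injective h) (ih.1 _ rfl)
      · rintro q rfl
        cases h
    · constructor
      · rintro p rfl
        cases h
      · rintro q rfl
        obtain ⟨l₁, l₂, i', x', rfl, h₁, h₂⟩ := ih.2 _ rfl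
        exact ⟨_ :: l₁, l₂, i', x', rfl, .down (Sum.inr_injective h) h₁, h₂⟩
  | @up u c k x l j y h _ ih =>
    rcases c with c | c
    · constructor
      · rintro p rfl
        exact .up (Sum.inl_injective h) (ih.1 _ rfl)
      · rintro q rfl
        cases h
    · constructor
      · rintro p rfl
        cases h
      · rintro q rfl
        obtain ⟨l₁, l₂, i', x', rfl, h₁, h₂⟩ := ih.2 _ rfl
        exact ⟨_ :: l₁, l₂, i', x', rfl, .up (Sum.inr_injective h) h₁, h₂⟩

theorem Run.fullRun_append {mC : C.Cell → Bool} {mμ : μ.Cell → Bool} {q : μ.Ports} {x x' y l l' i j}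
    (h : Run μ mμ q x l i x')
    (h' : FullRun C μ (Sum.elim mC mμ) (.inl (.free (.inl i))) x' l' j y) :
    FullRun C μ (Sum.elim mC mμ) (.inr q) x (l ++ l') j y := by
  induction h with
  | exit h =>
    have e : across C μ (.inr _) = .inr _ := congrArg Sum.inr h
    refine .hop ?_ ?_
    · rw [e]; intro h; cases h
    · rw [e]; exact h'
  | @down p c k _ _ _ _ h _ ih =>
    exact FullRun.down (c := .inr c) (m := Sum.elim mC mμ) (congrArg Sum.inr h) (ih h')
  | @up p c k _ _ _ _ h _ ih =>
    exact FullRun.up (c := .inr c) (m := Sum.elim mC mμ) (congrArg Sum.inr h) (ih h')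

theorem OracleRun.fullRun {mC : C.Cell → Bool} {mμ : μ.Cell → Bool} {p : C.Ports} {x y l j}
    (h : OracleRun C mC (fun i => Run μ mμ (.free i)) p x l j y) :
    FullRun C μ (Sum.elim mC mμ) (.inl p) x l j y := by
  induction h with
  | exit h => exact .exit (congrArg Sum.inl h)
  | call h h₁ _ ih =>
    have e : across C μ (.inl _) = .inl _ := congrArg Sum.inl h
    refine .hop ?_ ?_
    · rw [e]; intro h; cases h
    · rw [e]; exact h₁.fullRun_append ih
  | @down p c k _ _ _ _ h _ ih =>
    exact FullRun.down (c := .inl c) (m := Sum.elim mC mμ) (congrArg Sum.inl h) ih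
  | @up p c k _ _ _ _ h _ ih =>
    exact FullRun.up (c := .inl c) (m := Sum.elim mC mμ) (congrArg Sum.inl h) ih

/-- Compositionality: the runs of `C[μ]` alternate between runs in `C` and runs of `μ`. -/
theorem run_plug_iff [Finite I] [Finite J] {mC : C.Cell → Bool} {mμ : μ.Cell → Bool} {x y l}
    {i j : J} :
    Run (C.plug μ) (Sum.elim mC mμ) (.free i) x l j y ↔
      OracleRun C mC (fun i => Run μ mμ (.free i)) (.free (.inr i)) x l j y :=
  ⟨fun h => h.fullRun.oracleRun.1 _ rfl, fun h => h.fullRun.run (p := .free i)⟩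

theorem OracleRun.mono {m : C.Cell → Bool}
    {R R' : I → Cantor × Cantor → Itinerary → I → Cantor × Cantor → Prop}
    (hR : ∀ i x l j y, R i x l j y → ∃ l', R' i x l' j y) {p x l j y}
    (h : OracleRun C m R p x l j y) : ∃ l', OracleRun C m R' p x l' j y := by
  induction h with
  | exit h => exact ⟨_, .exit h⟩
  | call h h₁ _ ih =>
    obtain ⟨l, ih⟩ := ih
    obtain ⟨l₁, h₁⟩ := hR _ _ _ _ _ h₁
    exact ⟨_, .call h h₁ ih⟩
  | down h _ ih =>
    obtain ⟨l, ih⟩ := ih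
    exact ⟨_, .down h ih⟩
  | up h _ ih =>
    obtain ⟨l, ih⟩ := ih
    exact ⟨_, .up h ih⟩

theorem exec_plug_le [Finite I] [Finite J] (C : Net (I ⊕ J)) {μ ν : Net I}
    (h : μ.Exec = ν.Exec) {i x j y} (hx : (C.plug μ).Exec i x j y) : (C.plug ν).Exec i x j y := by
  rw [exec_iff (Sum.elim (fun _ => false) (fun _ => false))] at hx ⊢
  obtain ⟨l, hx⟩ := hx
  obtain ⟨l', hx⟩ := (run_plug_iff.mp hx).mono (R' := fun i => Run ν (fun _ => false) (.free i))
    (fun i x l j y r => by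
      have : μ.Exec i x j y := ⟨l, r⟩
      rwa [h] at this)
  exact ⟨l', run_plug_iff.mpr hx⟩

theorem exec_plug_congr [Finite I] [Finite J] (C : Net (I ⊕ J)) {μ ν : Net I}
    (h : μ.Exec = ν.Exec) : (C.plug μ).Exec = (C.plug ν).Exec := by
  ext i x j y
  exact ⟨exec_plug_le C h, exec_plug_le C h.symm⟩

end Oracle

theorem ContextClosure.exec_eq {R : ∀ ⦃I : Type⦄, Net I → Net I → Prop}
    (hR : ∀ ⦃I : Type⦄ (a b : Net I), R a b → a.Exec = b.Exec) {J : Type} [Finite J] {μ ν : Net J}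
    (h : ContextClosure R μ ν) : μ.Exec = ν.Exec := by
  obtain ⟨I, _, C, a, b, hab, hμ, hν⟩ := h
  rw [hμ.exec_eq, hν.exec_eq, exec_plug_congr C (hR _ _ hab)]

end Net

/-! ### The rules preserve the token machine -/

theorem BiWord.appendInf_append (s t : BiWord) (w : Cantor × Cantor) :
    (s.append t).appendInf w = s.appendInf (t.appendInf w) := by
  simp [BiWord.append, BiWord.appendInf, Stream'.append_append_stream]

theorem BiWord.nil_appendInf (w : Cantor × Cantor) : BiWord.appendInf ([], []) w = w := rfl

/-- Pushing a letter can be undone by popping it. -/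
theorem branch_appendInf_inj {α : CellSymbol} {k l : Fin α.arity} {x y : Cantor × Cantor}
    (h : (branch α k).appendInf x = (branch α l).appendInf y) : k = l ∧ x = y := by
  obtain ⟨x₁, x₂⟩ := x
  obtain ⟨y₁, y₂⟩ := y
  cases α with
  | epsilon => exact k.elim0
  | delta =>
    simp only [branch, BiWord.appendInf, Stream'.nil_append_stream, Stream'.cons_append_stream,
      Prod.mk.injEq] at h
    obtain ⟨h₁, rfl⟩ := h
    obtain ⟨h₁, rfl⟩ := Stream'.cons_injective2 h₁
    refine ⟨?_, rfl⟩
    change Fin 2 at k l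
    fin_cases k <;> fin_cases l <;> simp_all
  | zeta =>
    simp only [branch, BiWord.appendInf, Stream'.nil_append_stream, Stream'.cons_append_stream,
      Prod.mk.injEq] at h
    obtain ⟨rfl, h₁⟩ := h
    obtain ⟨h₁, rfl⟩ := Stream'.cons_injective2 h₁
    refine ⟨?_, rfl⟩
    change Fin 2 at k l
    fin_cases k <;> fin_cases l <;> simp_all

/-- Cells of different symbols act on different stacks, so that their actions commute. -/
theorem branch_comm {α β : CellSymbol} (h : α ≠ β) (k : Fin α.arity) (l : Fin β.arity)
    (x : Cantor × Cantor) :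
    (branch α k).appendInf ((branch β l).appendInf x) =
      (branch β l).appendInf ((branch α k).appendInf x) := by
  cases α <;> cases β <;> first | rfl | exact k.elim0 | exact l.elim0 | exact absurd rfl h

/-- A pop from one stack and a push on another one can be exchanged. -/
theorem branch_exchange {α β : CellSymbol} (h : α ≠ β) {k : Fin α.arity} {l : Fin β.arity}
    {x y : Cantor × Cantor} (e : (branch α k).appendInf x = (branch β l).appendInf y) :
    ∃ z, x = (branch β l).appendInf z ∧ y = (branch α k).appendInf z := by
  obtain ⟨x₁, x₂⟩ := x
  obtain ⟨y₁, y₂⟩ := y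
  cases α <;> cases β <;>
    first
    | exact k.elim0
    | exact l.elim0
    | exact absurd rfl h
    | (simp only [branch, BiWord.appendInf, Stream'.nil_append_stream,
        Stream'.cons_append_stream, Prod.mk.injEq] at e
       obtain ⟨rfl, rfl⟩ := e
       first
       | exact ⟨(x₁, y₂), rfl, rfl⟩
       | exact ⟨(y₁, x₂), rfl, rfl⟩)

namespace Net

/-- Inversion: the wire followed first determines the beginning of a run. -/
theorem Run.cases_wire {I : Type} {μ : Net I} {m p x l y} {j : I} (h : Run μ m p x l j y) :
    match μ.wire p with
    | .free i => l = [] ∧ j = i ∧ y = x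
    | .prin c => ∃ k x' l', x = (branch (μ.kind c) k).appendInf x' ∧ l = (.down, m c) :: l' ∧
        Run μ m (.aux c k) x' l' j y
    | .aux c k => ∃ l', l = (.up, m c) :: l' ∧
        Run μ m (.prin c) ((branch (μ.kind c) k).appendInf x) l' j y := by
  cases h with
  | exit h => rw [h]; exact ⟨rfl, rfl, rfl⟩
  | down h h' => rw [h]; exact ⟨_, _, _, rfl, rfl, h'⟩
  | up h h' => rw [h]; exact ⟨_, rfl, h'⟩

theorem run_activePair_inl {α β : CellSymbol} {m k x l j y} :
    Run (activePair α β) m (.free (.inl k)) x l j y ↔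
      ∃ k', l = [(.up, m (.inl ())), (.down, m (.inr ()))] ∧ j = .inr k' ∧
        (branch α k).appendInf x = (branch β k').appendInf y := by
  constructor
  · intro h
    obtain ⟨l', rfl, h₁⟩ := h.cases_wire
    obtain ⟨k', x', l'', e, rfl, h₂⟩ := h₁.cases_wire
    obtain ⟨rfl, rfl, rfl⟩ := h₂.cases_wire
    exact ⟨k', rfl, rfl, e⟩
  · rintro ⟨k', rfl, rfl, e⟩
    refine Run.up (μ := activePair α β) (c := Sum.inl ()) (k := k) rfl ?_
    change Run (activePair α β) m _ ((branch _ k).appendInf x) _ _ _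
    rw [e]
    exact Run.down (μ := activePair α β) (c := Sum.inr ()) (k := k') rfl (.exit rfl)

theorem run_activePair_inr {α β : CellSymbol} {m k x l j y} :
    Run (activePair α β) m (.free (.inr k)) x l j y ↔
      ∃ k', l = [(.up, m (.inr ())), (.down, m (.inl ()))] ∧ j = .inl k' ∧
        (branch β k).appendInf x = (branch α k').appendInf y := by
  constructor
  · intro h
    obtain ⟨l', rfl, h₁⟩ := h.cases_wire
    obtain ⟨k', x', l'', e, rfl, h₂⟩ := h₁.cases_wire
    obtain ⟨rfl, rfl, rfl⟩ := h₂.cases_wire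
    exact ⟨k', rfl, rfl, e⟩
  · rintro ⟨k', rfl, rfl, e⟩
    refine Run.up (μ := activePair α β) (c := Sum.inr ()) (k := k) rfl ?_
    change Run (activePair α β) m _ ((branch _ k).appendInf x) _ _ _
    rw [e]
    exact Run.down (μ := activePair α β) (c := Sum.inl ()) (k := k') rfl (.exit rfl)

theorem run_commuted_inl {α β : CellSymbol} {m k x l j y} :
    Run (commuted α β) m (.free (.inl k)) x l j y ↔
      ∃ k' z, l = [(.down, m (.inl k)), (.up, m (.inr k'))] ∧ j = .inr k' ∧
        x = (branch β k').appendInf z ∧ y = (branch α k).appendInf z := by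
  constructor
  · intro h
    obtain ⟨k', z, l', rfl, rfl, h₁⟩ := h.cases_wire
    obtain ⟨l', rfl, h₂⟩ := h₁.cases_wire
    obtain ⟨rfl, rfl, rfl⟩ := h₂.cases_wire
    exact ⟨k', z, rfl, rfl, rfl, rfl⟩
  · rintro ⟨k', z, rfl, rfl, rfl, rfl⟩
    exact Run.down (μ := commuted α β) (c := Sum.inl k) (k := k') rfl
      (.up (μ := commuted α β) (c := Sum.inr k') (k := k) rfl (.exit rfl))

theorem run_commuted_inr {α β : CellSymbol} {m k x l j y} :
    Run (commuted α β) m (.free (.inr k)) x l j y ↔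
      ∃ k' z, l = [(.down, m (.inr k)), (.up, m (.inl k'))] ∧ j = .inl k' ∧
        x = (branch α k').appendInf z ∧ y = (branch β k).appendInf z := by
  constructor
  · intro h
    obtain ⟨k', z, l', rfl, rfl, h₁⟩ := h.cases_wire
    obtain ⟨l', rfl, h₂⟩ := h₁.cases_wire
    obtain ⟨rfl, rfl, rfl⟩ := h₂.cases_wire
    exact ⟨k', z, rfl, rfl, rfl, rfl⟩
  · rintro ⟨k', z, rfl, rfl, rfl, rfl⟩
    exact Run.down (μ := commuted α β) (c := Sum.inr k) (k := k') rfl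
      (.up (μ := commuted α β) (c := Sum.inl k') (k := k) rfl (.exit rfl))

theorem run_parallelWires_inl {K : Type} {m} {k : K} {x l j y} :
    Run (parallelWires K) m (.free (.inl k)) x l j y ↔ l = [] ∧ j = .inr k ∧ y = x :=
  ⟨fun h => h.cases_wire, by rintro ⟨rfl, rfl, rfl⟩; exact .exit rfl⟩

theorem run_parallelWires_inr {K : Type} {m} {k : K} {x l j y} :
    Run (parallelWires K) m (.free (.inr k)) x l j y ↔ l = [] ∧ j = .inl k ∧ y = x :=
  ⟨fun h => h.cases_wire, by rintro ⟨rfl, rfl, rfl⟩; exact .exit rfl⟩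

theorem BetaRule.exec_eq ⦃I : Type⦄ (a b : Net I) (h : BetaRule a b) : a.Exec = b.Exec := by
  cases h with
  | annihilation α =>
    ext (k | k) x j y
    · simp only [Exec, run_activePair_inl, run_parallelWires_inl]
      constructor
      · rintro ⟨_, k', -, rfl, e⟩
        obtain ⟨rfl, rfl⟩ := branch_appendInf_inj e
        exact ⟨_, rfl, rfl, rfl⟩
      · rintro ⟨_, -, rfl, rfl⟩
        exact ⟨_, _, rfl, rfl, rfl⟩
    · simp only [Exec, run_activePair_inr, run_parallelWires_inr]
      constructor
      · rintro ⟨_, k', -, rfl, e⟩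
        obtain ⟨rfl, rfl⟩ := branch_appendInf_inj e
        exact ⟨_, rfl, rfl, rfl⟩
      · rintro ⟨_, -, rfl, rfl⟩
        exact ⟨_, _, rfl, rfl, rfl⟩
  | commutation α β h =>
    ext (k | k) x j y
    · simp only [Exec, run_activePair_inl, run_commuted_inl]
      constructor
      · rintro ⟨_, k', -, rfl, e⟩
        obtain ⟨z, rfl, rfl⟩ := branch_exchange h e
        exact ⟨_, _, _, rfl, rfl, rfl, rfl⟩
      · rintro ⟨_, k', z, -, rfl, rfl, rfl⟩
        exact ⟨_, _, rfl, rfl, branch_comm h _ _ _⟩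
    · simp only [Exec, run_activePair_inr, run_commuted_inr]
      constructor
      · rintro ⟨_, k', -, rfl, e⟩
        obtain ⟨z, rfl, rfl⟩ := branch_exchange h.symm e
        exact ⟨_, _, _, rfl, rfl, rfl, rfl⟩
      · rintro ⟨_, k', z, -, rfl, rfl, rfl⟩
        exact ⟨_, _, rfl, rfl, branch_comm h.symm _ _ _⟩

/-- On an infinite stack there is always a letter to pop. -/
theorem exists_branch {α : CellSymbol} (h : α ≠ .epsilon) (x : Cantor × Cantor) :
    ∃ k z, x = (branch α k).appendInf z := by
  obtain ⟨x₁, x₂⟩ := x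
  cases α with
  | epsilon => exact absurd rfl h
  | delta =>
    refine ⟨if x₁.head then 1 else 0, (x₁.tail, x₂), ?_⟩
    refine Prod.ext ?_ rfl
    conv_lhs => rw [← Stream'.eta x₁]
    change _ = Stream'.cons _ _
    cases x₁.head <;> rfl
  | zeta =>
    refine ⟨if x₂.head then 1 else 0, (x₁, x₂.tail), ?_⟩
    refine Prod.ext rfl ?_
    conv_lhs => rw [← Stream'.eta x₂]
    change _ = Stream'.cons _ _
    cases x₂.head <;> rfl

theorem EtaZeroRule.exec_eq ⦃I : Type⦄ (a b : Net I) (h : EtaZeroRule a b) : a.Exec = b.Exec := by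
  obtain ⟨α, h⟩ := h
  ext (k | k) x j y
  · simp only [Exec, run_parallelWires_inl]
    constructor
    · rintro ⟨l, h⟩
      obtain ⟨k', z, l, rfl, rfl, h₁⟩ := h.cases_wire
      obtain ⟨l, rfl, h₂⟩ := h₁.cases_wire
      exact ⟨_, rfl, h₂.cases_wire.2⟩
    · rintro ⟨_, -, rfl, rfl⟩
      obtain ⟨k', z, rfl⟩ := exists_branch h y
      exact ⟨_, Run.down (μ := etaZeroPair α) (c := Sum.inl ()) (k := k') rfl
        (.up (μ := etaZeroPair α) (c := Sum.inr ()) (k := k') rfl (.exit rfl))⟩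
  · simp only [Exec, run_parallelWires_inr]
    constructor
    · rintro ⟨l, h⟩
      obtain ⟨k', z, l, rfl, rfl, h₁⟩ := h.cases_wire
      obtain ⟨l, rfl, h₂⟩ := h₁.cases_wire
      exact ⟨_, rfl, h₂.cases_wire.2⟩
    · rintro ⟨_, -, rfl, rfl⟩
      obtain ⟨k', z, rfl⟩ := exists_branch h y
      exact ⟨_, Run.down (μ := etaZeroPair α) (c := Sum.inr ()) (k := k') rfl
        (.up (μ := etaZeroPair α) (c := Sum.inl ()) (k := k') rfl (.exit rfl))⟩

theorem exec_etaOneLeft_root {α β : CellSymbol} {x j y} :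
    (etaOneLeft α β).Exec (.inl ()) x j y ↔ ∃ i k, j = .inr (i, k) ∧
      x = (branch α i).appendInf ((branch β k).appendInf y) := by
  constructor
  · rintro ⟨l, h⟩
    obtain ⟨i, z, l, rfl, rfl, h₁⟩ := h.cases_wire
    obtain ⟨k, z, l, rfl, rfl, h₂⟩ := h₁.cases_wire
    obtain ⟨rfl, rfl, rfl⟩ := h₂.cases_wire
    exact ⟨i, k, rfl, rfl⟩
  · rintro ⟨i, k, rfl, rfl⟩
    exact ⟨_, Run.down (μ := etaOneLeft α β) (c := Sum.inl ()) (k := i) rfl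
      (.down (μ := etaOneLeft α β) (c := Sum.inr i) (k := k) rfl (.exit rfl))⟩

theorem exec_etaOneRight_root {α β : CellSymbol} {x j y} :
    (etaOneRight α β).Exec (.inl ()) x j y ↔ ∃ i k, j = .inr (i, k) ∧
      x = (branch β k).appendInf ((branch α i).appendInf y) := by
  constructor
  · rintro ⟨l, h⟩
    obtain ⟨k, z, l, rfl, rfl, h₁⟩ := h.cases_wire
    obtain ⟨i, z, l, rfl, rfl, h₂⟩ := h₁.cases_wire
    obtain ⟨rfl, rfl, rfl⟩ := h₂.cases_wire
    exact ⟨i, k, rfl, rfl⟩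
  · rintro ⟨i, k, rfl, rfl⟩
    exact ⟨_, Run.down (μ := etaOneRight α β) (c := Sum.inl ()) (k := k) rfl
      (.down (μ := etaOneRight α β) (c := Sum.inr k) (k := i) rfl (.exit rfl))⟩

theorem exec_etaOneLeft_leaf {α β : CellSymbol} {i k x j y} :
    (etaOneLeft α β).Exec (.inr (i, k)) x j y ↔ j = .inl () ∧
      y = (branch α i).appendInf ((branch β k).appendInf x) := by
  constructor
  · rintro ⟨l, h⟩
    obtain ⟨l, rfl, h₁⟩ := h.cases_wire
    obtain ⟨l, rfl, h₂⟩ := h₁.cases_wire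
    exact h₂.cases_wire.2
  · rintro ⟨rfl, rfl⟩
    exact ⟨_, Run.up (μ := etaOneLeft α β) (c := Sum.inr i) (k := k) rfl
      (.up (μ := etaOneLeft α β) (c := Sum.inl ()) (k := i) rfl (.exit rfl))⟩

theorem exec_etaOneRight_leaf {α β : CellSymbol} {i k x j y} :
    (etaOneRight α β).Exec (.inr (i, k)) x j y ↔ j = .inl () ∧
      y = (branch β k).appendInf ((branch α i).appendInf x) := by
  constructor
  · rintro ⟨l, h⟩
    obtain ⟨l, rfl, h₁⟩ := h.cases_wire
    obtain ⟨l, rfl, h₂⟩ := h₁.cases_wire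
    exact h₂.cases_wire.2
  · rintro ⟨rfl, rfl⟩
    exact ⟨_, Run.up (μ := etaOneRight α β) (c := Sum.inr k) (k := i) rfl
      (.up (μ := etaOneRight α β) (c := Sum.inl ()) (k := k) rfl (.exit rfl))⟩

theorem EtaOneRule.exec_eq ⦃I : Type⦄ (a b : Net I) (h : EtaOneRule a b) : a.Exec = b.Exec := by
  obtain ⟨α, β, h⟩ := h
  ext (⟨⟩ | ⟨i, k⟩) x j y
  · refine exec_etaOneLeft_root.trans (Iff.trans ?_ exec_etaOneRight_root.symm)
    simp only [branch_comm h]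
  · refine exec_etaOneLeft_leaf.trans (Iff.trans ?_ exec_etaOneRight_leaf.symm)
    simp only [branch_comm h]

theorem not_exec_epsNet {k : ℕ} {i x j y} : ¬ (epsNet k).Exec i x j y := by
  rintro ⟨l, h⟩
  obtain ⟨k, -⟩ := h.cases_wire
  exact k.elim0

theorem BetaRed.exec_eq {J : Type} [Finite J] {μ ν : Net J} (h : BetaRed μ ν) :
    μ.Exec = ν.Exec := by
  induction h with
  | refl => rfl
  | tail _ h ih => exact ih.trans (h.elim AlphaEq.exec_eq (ContextClosure.exec_eq BetaRule.exec_eq))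

theorem EquationalClosure.exec_eq {R : ∀ ⦃I : Type⦄, Net I → Net I → Prop}
    (hR : ∀ ⦃I : Type⦄ (a b : Net I), R a b → a.Exec = b.Exec) {J : Type} [Finite J] {μ ν : Net J}
    (h : EquationalClosure R μ ν) : μ.Exec = ν.Exec := by
  induction h with
  | refl => rfl
  | tail _ h ih =>
    rcases h with h | h | h
    · exact ih.trans h.exec_eq
    · exact ih.trans (h.exec_eq hR)
    · exact ih.trans (h.exec_eq hR).symm

/-! ### Runs along observable axioms -/

/-- `Path μ r s p`: going up from the root `r`, cells are entered by their principal ports along a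
branch that ends at the port `p`, whose address is `s`. -/
inductive Path {I : Type} (μ : Net I) : μ.Ports → BiWord → μ.Ports → Prop
  | refl (r : μ.Ports) : Path μ r ([], []) r
  | step {r c k s p} : μ.wire r = .prin c → Path μ (.aux c k) s p →
      Path μ r ((branch (μ.kind c) k).append s) p

section Path

variable {I : Type} {μ : Net I}

theorem IsLeaf.path {τ : Tree} {r p : μ.Ports} {s : BiWord} (h : IsLeaf μ τ r s p) :
    Path μ r s p := by
  induction h with
  | wire r => exact .refl r
  | node r c t k s p h _ ih => exact .step h ih

/-- A branch is a tree all of whose side branches are wires. -/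
theorem Path.exists_tree {r p : μ.Ports} {s : BiWord} (h : Path μ r s p) :
    ∃ τ, HasTree μ τ r ∧ IsLeaf μ τ r s p := by
  classical
  induction h with
  | refl r => exact ⟨_, .wire r, .wire r⟩
  | @step r c k s p h _ ih =>
    obtain ⟨τ, h₁, h₂⟩ := ih
    refine ⟨.node (μ.kind c) fun k' => if k' = k then τ else .wire,
      .node r c _ h fun k' => ?_, .node r c _ k s p h (by simpa using h₂)⟩
    by_cases hk : k' = k
    · subst hk; simpa using h₁
    · simpa [hk] using HasTree.wire _

theorem BiWord.append_assoc (s t u : BiWord) : (s.append t).append u = s.append (t.append u) := by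
  simp [BiWord.append]

theorem Path.trans {r p q : μ.Ports} {s t : BiWord} (h : Path μ r s p) (h' : Path μ p t q) :
    Path μ r (s.append t) q := by
  induction h with
  | refl r => exact h'
  | step h _ ih => rw [BiWord.append_assoc]; exact .step h (ih h')

theorem Path.ne_prin {r p : μ.Ports} {s : BiWord} (h : Path μ r s p) (hr : ∀ c, r ≠ .prin c) (c) :
    p ≠ .prin c := by
  induction h with
  | refl r => exact hr c
  | step h _ ih => exact ih fun _ => nofun

theorem Path.run_down {m} {r p : μ.Ports} {s : BiWord} (h : Path μ r s p) {x l j y}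
    (hp : Run μ m p x l j y) : ∃ l', Run μ m r (s.appendInf x) l' j y := by
  induction h with
  | refl r => exact ⟨l, hp⟩
  | step h _ ih =>
    obtain ⟨l', ih⟩ := ih hp
    exact ⟨_, by rw [BiWord.appendInf_append]; exact .down h ih⟩

theorem Path.run_up {m} {r p : μ.Ports} {s : BiWord} (h : Path μ r s p) {x l j y}
    (hr : Run μ m (μ.wire r) (s.appendInf x) l j y) : ∃ l', Run μ m (μ.wire p) x l' j y := by
  induction h generalizing l with
  | refl r => exact ⟨l, hr⟩
  | step h _ ih =>
    rw [BiWord.appendInf_append, h] at hr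
    exact ih (.up (μ.wire_wire _) hr)

end Path

/-- A token crosses an observable axiom down one tree and up the other. -/
theorem exec_of_mem_vault {n : ℕ} {μ : Net (Fin n)} {x : Address} (hx : x ∈ μ.ObsPaths) {a : Arch}
    (ha : a ∈ vault x) : ∃ i u j v, μ.Exec i u j v ∧ a = s((u, i.val + 1), (v, j.val + 1)) := by
  obtain ⟨p, i, j, τ, τ', s, t, -, -, hs, -, ht, rfl⟩ := hx
  obtain ⟨s', t', i', j', w, e, rfl⟩ := ha
  have h₀ : Run μ (fun _ => false) (μ.wire (.free j)) (t.appendInf w) [] j (t.appendInf w) :=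
    .exit (μ.wire_wire _)
  obtain ⟨l, h₁⟩ := ht.path.run_up h₀
  rw [wire_wire] at h₁
  obtain ⟨l, h₂⟩ := hs.path.run_down h₁
  refine ⟨i, _, j, _, ⟨l, h₂⟩, ?_⟩
  rcases Sym2.eq_iff.mp e with ⟨h, h'⟩ | ⟨h, h'⟩
  · cases h; cases h'; rfl
  · cases h; cases h'; exact Sym2.eq_swap

/-! ### Inversions of an itinerary -/

/-- Number of upward moves. -/
def ups : List Dir → ℕ
  | [] => 0
  | .up :: w => ups w + 1
  | .down :: w => ups w

/-- Number of downward moves. -/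
def downs : List Dir → ℕ
  | [] => 0
  | .up :: w => downs w
  | .down :: w => downs w + 1

/-- Number of pairs made of an upward move and of a later downward move. -/
def inversions : List Dir → ℕ
  | [] => 0
  | .up :: w => inversions w + downs w
  | .down :: w => inversions w

theorem ups_append (v w : List Dir) : ups (v ++ w) = ups v + ups w := by
  induction v with
  | nil => simp [ups]
  | cons d v ih => cases d <;> grind [ups]

theorem downs_append (v w : List Dir) : downs (v ++ w) = downs v + downs w := by
  induction v with
  | nil => simp [downs]
  | cons d v ih => cases d <;> grind [downs]

theorem inversions_append (v w : List Dir) :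
    inversions (v ++ w) = inversions v + inversions w + ups v * downs w := by
  induction v with
  | nil => simp [inversions, ups]
  | cons d v ih =>
    cases d <;> simp only [List.cons_append, inversions, ups, downs_append, ih]
    ring

/-- The comparison of words of moves that is preserved by concatenation. -/
structure Simpler (v w : List Dir) : Prop where
  ups_le : ups v ≤ ups w
  downs_le : downs v ≤ downs w
  inversions_le : inversions v ≤ inversions w

theorem Simpler.cons {v w : List Dir} (h : Simpler v w) (d : Dir) : Simpler (d :: v) (d :: w) := by
  obtain ⟨h₁, h₂, h₃⟩ := h
  cases d <;> constructor <;> (simp only [ups, downs, inversions]; omega)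

/-- A word of moves without inversion that begins with an upward move has only upward moves. -/
theorem downs_eq_zero {w : List Dir} (h : inversions (.up :: w) = 0) : downs w = 0 := by
  simp only [inversions] at h
  omega

/-- If every call of the oracle `R` can be answered by `R'` with less inversions, then a run using
`R` is turned into a run using `R'`, with less inversions if `R` is called at all; the latter is the
case when a marked cell is crossed, since the cells of `C` are not marked. -/
theorem OracleRun.simplify {I J : Type} {C : Net (I ⊕ J)}
    {R R' : I → Cantor × Cantor → Itinerary → I → Cantor × Cantor → Prop}
    (hR : ∀ i x l j y, R i x l j y → ∃ l' : Itinerary, R' i x l' j y ∧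
      Simpler (l'.map Prod.fst) (l.map Prod.fst) ∧
      inversions (l'.map Prod.fst) < inversions (l.map Prod.fst))
    {p x l j y} (h : OracleRun C (fun _ => false) R p x l j y) :
    ∃ l', OracleRun C (fun _ => false) R' p x l' j y ∧
      Simpler (l'.map Prod.fst) (l.map Prod.fst) ∧
      ((∃ a ∈ l, a.2 = true) → inversions (l'.map Prod.fst) < inversions (l.map Prod.fst)) := by
  induction h with
  | exit h => exact ⟨_, .exit h, ⟨le_rfl, le_rfl, le_rfl⟩, by simp⟩
  | call h h₁ _ ih =>
    obtain ⟨l', ih, s, -⟩ := ih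
    obtain ⟨l₁, h₁, s₁, lt⟩ := hR _ _ _ _ _ h₁
    -- The inversions between the two parts of a concatenation are counted by a product.
    have hmul := Nat.mul_le_mul s₁.ups_le s.downs_le
    have := s.inversions_le
    refine ⟨_, .call h h₁ ih, ⟨?_, ?_, ?_⟩, fun _ => ?_⟩
    · simp only [List.map_append, ups_append]
      exact add_le_add s₁.ups_le s.ups_le
    · simp only [List.map_append, downs_append]
      exact add_le_add s₁.downs_le s.downs_le
    · simp only [List.map_append, inversions_append]
      omega
    · simp only [List.map_append, inversions_append]
      omega
  | down h _ ih =>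
    obtain ⟨l', ih, s, lt⟩ := ih
    refine ⟨_, .down h ih, s.cons _, fun ha => ?_⟩
    simpa [inversions] using lt (by simpa using ha)
  | up h _ ih =>
    obtain ⟨l', ih, s, lt⟩ := ih
    refine ⟨_, .up h ih, s.cons _, fun ha => ?_⟩
    exact add_lt_add_of_lt_of_le (lt (by simpa using ha)) s.downs_le

/-- Firing an active pair removes the only inversion of the runs through it. -/
theorem BetaRule.simplify ⦃I : Type⦄ {a b : Net I} (h : BetaRule a b) {m m'} {i x l j y}
    (r : Run a m (.free i) x l j y) : ∃ l', Run b m' (.free i) x l' j y ∧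
      Simpler (l'.map Prod.fst) (l.map Prod.fst) ∧
      inversions (l'.map Prod.fst) < inversions (l.map Prod.fst) := by
  cases h with
  | annihilation α =>
    rcases i with k | k
    · obtain ⟨k', rfl, rfl, e⟩ := run_activePair_inl.mp r
      obtain ⟨rfl, rfl⟩ := branch_appendInf_inj e
      exact ⟨[], run_parallelWires_inl.mpr ⟨rfl, rfl, rfl⟩,
        ⟨Nat.zero_le _, Nat.zero_le _, Nat.zero_le _⟩, Nat.zero_lt_one⟩
    · obtain ⟨k', rfl, rfl, e⟩ := run_activePair_inr.mp r
      obtain ⟨rfl, rfl⟩ := branch_appendInf_inj e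
      exact ⟨[], run_parallelWires_inr.mpr ⟨rfl, rfl, rfl⟩,
        ⟨Nat.zero_le _, Nat.zero_le _, Nat.zero_le _⟩, Nat.zero_lt_one⟩
  | commutation α β h =>
    rcases i with k | k
    · obtain ⟨k', rfl, rfl, e⟩ := run_activePair_inl.mp r
      obtain ⟨z, rfl, rfl⟩ := branch_exchange h e
      exact ⟨_, run_commuted_inl.mpr ⟨k', z, rfl, rfl, rfl, rfl⟩,
        ⟨le_rfl, le_rfl, Nat.zero_le _⟩, Nat.zero_lt_one⟩
    · obtain ⟨k', rfl, rfl, e⟩ := run_activePair_inr.mp r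
      obtain ⟨z, rfl, rfl⟩ := branch_exchange h.symm e
      exact ⟨_, run_commuted_inr.mpr ⟨k', z, rfl, rfl, rfl, rfl⟩,
        ⟨le_rfl, le_rfl, Nat.zero_le _⟩, Nat.zero_lt_one⟩

/-- A run with an inversion goes through an active pair, where an upward move is followed by a
downward one.  That it crosses the cell `c` is expressed by marking this cell. -/
theorem Run.exists_activePair {I : Type} {μ : Net I} {m : μ.Cell → Bool} {p : μ.Ports} {x l j y}
    (r : Run μ m p x l j y) (hl : 0 < inversions (l.map Prod.fst)) :
    ∃ c c', μ.wire (.prin c) = .prin c' ∧ ∀ m' : μ.Cell → Bool, m' c = true →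
      ∃ l' : Itinerary, l'.map Prod.fst = l.map Prod.fst ∧ Run μ m' p x l' j y ∧
        ∃ a ∈ l', a.2 = true := by
  induction r with
  | exit h => simp [inversions] at hl
  | down h _ ih =>
    obtain ⟨c, c', hc, H⟩ := ih hl
    refine ⟨c, c', hc, fun m' hm => ?_⟩
    obtain ⟨l', e, r, a, ha, ha'⟩ := H m' hm
    exact ⟨_ :: l', by simp [e], .down h r, a, List.mem_cons_of_mem _ ha, ha'⟩
  | @up p c k x l j y h r ih =>
    by_cases hl' : 0 < inversions (l.map Prod.fst)
    · obtain ⟨c, c', hc, H⟩ := ih hl'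
      refine ⟨c, c', hc, fun m' hm => ?_⟩
      obtain ⟨l', e, r, a, ha, ha'⟩ := H m' hm
      exact ⟨_ :: l', by simp [e], .up h r, a, List.mem_cons_of_mem _ ha, ha'⟩
    · have hd : downs (l.map Prod.fst) ≠ 0 := by
        simp only [List.map_cons, inversions] at hl
        omega
      -- The upward move through `c` belongs to an inversion, but the moves after it do not: hence
      -- the next one is downward.
      have hc : ∀ {x'}, Run μ m (.prin c) x' l j y → ∃ c', μ.wire (.prin c) = .prin c' := by
        intro x' r
        cases r with
        | exit => exact absurd rfl hd
        | down hc => exact ⟨_, hc⟩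
        | up => exact absurd (downs_eq_zero (Nat.eq_zero_of_not_pos hl')) hd
      obtain ⟨c', hc⟩ := hc r
      refine ⟨c, c', hc, fun m' hm => ?_⟩
      obtain ⟨l', e, r⟩ := r.remark m'
      exact ⟨_ :: l', by simp [e], .up h r, _, List.mem_cons_self, hm⟩

/-! ### Observable axioms from runs without inversions -/

/-- A run that only goes up climbs a branch from its leaf to its root. -/
theorem Run.exists_path_up {I : Type} {μ : Net I} {m : μ.Cell → Bool} {p : μ.Ports} {x l j y}
    (r : Run μ m p x l j y) (hl : downs (l.map Prod.fst) = 0) :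
    ∃ t, Path μ (.free j) t (μ.wire p) ∧ y = t.appendInf x := by
  induction r with
  | exit h => exact ⟨([], []), h ▸ .refl _, rfl⟩
  | down => simp [downs] at hl
  | @up p c k x l j y h _ ih =>
    obtain ⟨t, ht, rfl⟩ := ih hl
    have := Path.step (μ.wire_wire (.prin c)) (.refl (.aux c k))
    rw [h]
    refine ⟨_, ht.trans this, ?_⟩
    simp only [BiWord.appendInf_append, BiWord.nil_appendInf]

/-- A run without inversion goes down a branch, along a wire, and up another branch. -/
theorem Run.exists_paths {I : Type} {μ : Net I} {m : μ.Cell → Bool} {p : μ.Ports} {x l j y}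
    (r : Run μ m p x l j y) (hl : inversions (l.map Prod.fst) = 0) :
    ∃ q s t w, Path μ p s q ∧ Path μ (.free j) t (μ.wire q) ∧ x = s.appendInf w ∧
      y = t.appendInf w := by
  induction r with
  | @exit p j x h => exact ⟨p, ([], []), ([], []), x, .refl _, h ▸ .refl _, rfl, rfl⟩
  | down h _ ih =>
    obtain ⟨q, s, t, w, hs, ht, rfl, rfl⟩ := ih hl
    exact ⟨q, _, t, w, .step h hs, ht, (BiWord.appendInf_append _ _ _).symm, rfl⟩
  | @up p c k x l j y h r _ =>
    obtain ⟨t, ht, rfl⟩ := (Run.up h r).exists_path_up (downs_eq_zero (w := l.map _) hl)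
    exact ⟨p, ([], []), t, x, .refl _, ht, rfl, rfl⟩

theorem Run.exists_obsPath {n : ℕ} {μ : Net (Fin n)} {m : μ.Cell → Bool} {i j : Fin n} {x y l}
    (r : Run μ m (.free i) x l j y) (hl : inversions (l.map Prod.fst) = 0) :
    ∃ a ∈ μ.ObsPaths, s((x, i.val + 1), (y, j.val + 1)) ∈ vault a := by
  obtain ⟨q, s, t, w, hs, ht, rfl, rfl⟩ := r.exists_paths hl
  obtain ⟨τ, h₁, h₂⟩ := hs.exists_tree
  obtain ⟨τ', h₁', h₂'⟩ := ht.exists_tree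
  exact ⟨_, ⟨q, i, j, τ, τ', s, t, fun c => ⟨hs.ne_prin (fun _ => nofun) c,
    ht.ne_prin (fun _ => nofun) c⟩, h₁, h₂, h₁', h₂', rfl⟩, s, t, _, _, w, rfl, rfl⟩

/-! ### Extraction of an active pair -/

section Residue

variable {J : Type} (μ : Net J) (c c' : μ.Cell)

/-- The cells other than `c` and `c'`. -/
abbrev ResidueCell : Type := {d : μ.Cell // d ≠ c ∧ d ≠ c'}

/-- The interface of the context obtained by removing `c` and `c'`. -/
abbrev ResidueInterface : Type :=
  (Fin (μ.kind c).arity ⊕ Fin (μ.kind c').arity) ⊕ J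

/-- The ports of the context obtained by removing `c` and `c'`, as ports of `μ`: the free ports to
be plugged are the auxiliary ports of `c` and `c'`. -/
def residueEmb : Port (ResidueInterface μ c c') (ResidueCell μ c c') (fun d => μ.kind d) → μ.Ports
  | .free (.inl (.inl k)) => .aux c k
  | .free (.inl (.inr k)) => .aux c' k
  | .free (.inr j) => .free j
  | .prin d => .prin d
  | .aux d k => .aux d k

variable {μ c c'}

theorem residueEmb_injective (hne : c ≠ c') : Function.Injective (residueEmb μ c c') := by
  intro p q h
  rcases p with ((k | k) | j) | d | ⟨d, k⟩ <;> rcases q with ((k' | k') | j') | d' | ⟨d', k'⟩ <;>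
    simp only [residueEmb, reduceCtorEq, Port.aux.injEq, Port.free.injEq, Port.prin.injEq] at h
  · obtain ⟨-, h⟩ := h; cases h; rfl
  · exact absurd h.1 hne
  · exact absurd h.1.symm d'.2.1
  · exact absurd h.1.symm hne
  · obtain ⟨-, h⟩ := h; cases h; rfl
  · exact absurd h.1.symm d'.2.2
  · rw [h]
  · rw [Subtype.ext h]
  · exact absurd h.1 d.2.1
  · exact absurd h.1 d.2.2
  · obtain ⟨d, hd⟩ := d
    obtain ⟨d', hd'⟩ := d'
    obtain ⟨h, h'⟩ := h
    change d = d' at h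
    subst h
    cases h'
    rfl

theorem exists_residueEmb {p : μ.Ports} (h : p ≠ .prin c) (h' : p ≠ .prin c') :
    ∃ q, residueEmb μ c c' q = p := by
  classical
  rcases p with j | d | ⟨d, k⟩
  · exact ⟨.free (.inr j), rfl⟩
  · exact ⟨.prin ⟨d, fun e => h (e ▸ rfl), fun e => h' (e ▸ rfl)⟩, rfl⟩
  · by_cases e : d = c
    · subst e; exact ⟨.free (.inl (.inl k)), rfl⟩
    · by_cases e' : d = c'
      · subst e'; exact ⟨.free (.inl (.inr k)), rfl⟩
      · exact ⟨.aux ⟨d, e, e'⟩ k, rfl⟩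

theorem residueEmb_ne (q) : residueEmb μ c c' q ≠ .prin c ∧ residueEmb μ c c' q ≠ .prin c' := by
  rcases q with ((k | k) | j) | ⟨d, hd⟩ | ⟨d, k⟩
  case prin => simp [residueEmb, hd]
  all_goals simp [residueEmb]

theorem exists_residue_wire (hc : μ.wire (.prin c) = .prin c') (q) :
    ∃ q', residueEmb μ c c' q' = μ.wire (residueEmb μ c c' q) := by
  obtain ⟨h, h'⟩ := residueEmb_ne q
  apply exists_residueEmb
  · intro e
    apply h'
    rw [← hc, ← e, wire_wire]
  · intro e
    apply h
    rw [← μ.wire_wire (.prin c), hc, ← e, wire_wire]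

theorem ne_of_wire_prin (hc : μ.wire (.prin c) = .prin c') : c ≠ c' := fun e =>
  μ.wire_ne _ (hc.trans (e ▸ rfl))

/-- The context obtained from `μ` by removing the active pair `c`, `c'`. -/
noncomputable def residue (hc : μ.wire (.prin c) = .prin c') : Net (ResidueInterface μ c c') where
  Cell := ResidueCell μ c c'
  finite_cell := inferInstance
  kind d := μ.kind d
  wire q := (exists_residue_wire hc q).choose
  wire_wire q := by
    apply residueEmb_injective (ne_of_wire_prin hc)
    rw [(exists_residue_wire hc _).choose_spec, (exists_residue_wire hc q).choose_spec, wire_wire]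
  wire_ne q h := by
    have := (exists_residue_wire hc q).choose_spec
    rw [h] at this
    exact μ.wire_ne _ this.symm
  loops := μ.loops

theorem residueEmb_wire (hc : μ.wire (.prin c) = .prin c') (q : (residue hc).Ports) :
    residueEmb μ c c' ((residue hc).wire q) = μ.wire (residueEmb μ c c' q) :=
  (exists_residue_wire hc q).choose_spec

/-- Cells of the residue together with an active pair, as cells of the original net. -/
def residueCellMap (μ : Net J) (c c' : μ.Cell) : ResidueCell μ c c' ⊕ (Unit ⊕ Unit) → μ.Cell
  | .inl d => d
  | .inr (.inl _) => c
  | .inr (.inr _) => c'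

theorem residueCellMap_bijective (hne : c ≠ c') :
    Function.Bijective (residueCellMap μ c c') := by
  classical
  constructor
  · rintro (⟨d, hd⟩ | ⟨⟨⟩⟩ | ⟨⟨⟩⟩) (⟨d', hd'⟩ | ⟨⟨⟩⟩ | ⟨⟨⟩⟩) h <;>
      simp only [residueCellMap] at h <;> first
      | rfl
      | (subst h; rfl)
      | exact absurd h hne
      | exact absurd h.symm hne
      | exact absurd h hd.1
      | exact absurd h hd.2
      | exact absurd h.symm hd'.1
      | exact absurd h.symm hd'.2
  · intro d
    by_cases e : d = c
    · exact ⟨.inr (.inl ()), e.symm⟩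
    · by_cases e' : d = c'
      · exact ⟨.inr (.inr ()), e'.symm⟩
      · exact ⟨.inl ⟨d, e, e'⟩, rfl⟩

end Residue

section Plug

variable {I J : Type} {C : Net (I ⊕ J)} {μ : Net I}

/-- From the port `w` of `C` or `μ`, the first port that is not plugged is `v`. -/
inductive Hop : Full C μ → Full C μ → Prop
  | refl {v} : ¬ Plugged C μ v → Hop v v
  | step {w v} : Plugged C μ w → Hop (across C μ (swap C μ w)) v → Hop w v

theorem Hop.endOf {u v : Full C μ} (hu : ¬ Plugged C μ u) (h : Hop (across C μ u) v) :
    EndOf u v := by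
  have key : ¬ Plugged C μ v ∧ ∃ k, (next C μ)^[k] (across C μ u) = v ∧
      ∀ j < k, Plugged C μ ((next C μ)^[j] (across C μ u)) := by
    generalize across C μ u = w at h
    induction h with
    | refl h => exact ⟨h, 0, rfl, fun j hj => absurd hj (Nat.not_lt_zero j)⟩
    | step h _ ih =>
      obtain ⟨hv, k, rfl, ih⟩ := ih
      refine ⟨hv, k + 1, rfl, fun j hj => ?_⟩
      rcases j with _ | j
      · exact h
      · exact ih j (by omega)
  obtain ⟨hv, k, rfl, hk⟩ := key
  have e : next C μ u = across C μ u := by rw [next, not_not.mp hu]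
  refine ⟨k + 1, k.succ_pos, by rw [Function.iterate_succ_apply, e], hu, hv, fun j hj hjk => ?_⟩
  obtain ⟨j, rfl⟩ : ∃ i, j = i + 1 := ⟨j - 1, by omega⟩
  rw [Function.iterate_succ_apply, e]
  exact hk j (by omega)

theorem wire_plug_eq [Finite I] [Finite J] {p q : (C.plug μ).Ports}
    (h : Hop (across C μ (toFull C μ p)) (toFull C μ q)) : (C.plug μ).wire p = q :=
  toFull_injective ((plug_endOf p).unique (h.endOf (not_plugged_toFull p)))

/-- No loop is created when every plugged port is on the same line as an unplugged one. -/
theorem newLoops_eq_zero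
    (h : ∀ x, Plugged C μ x → ∃ y, SameLine C μ x y ∧ ¬ Plugged C μ y) : newLoops C μ = 0 := by
  rw [newLoops, Nat.card_eq_zero]
  left
  constructor
  rintro ⟨l, hl⟩
  induction l using Quotient.inductionOn with
  | _ x =>
    obtain ⟨y, hxy, hy⟩ := h x (hl x rfl)
    exact hy (hl y (Quotient.sound ((SameLine C μ).symm hxy)))

theorem newLoops_activePair {α β : CellSymbol} (C : Net ((Fin α.arity ⊕ Fin β.arity) ⊕ J)) :
    newLoops C (activePair α β) = 0 := by
  apply newLoops_eq_zero
  have key : ∀ i, ∃ y, SameLine C (activePair α β) (.inr (.free i)) y ∧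
      ¬ Plugged C (activePair α β) y := by
    rintro (k | k)
    · exact ⟨.inr (.aux (.inl ()) k), .rel _ _ (.inl rfl), fun h => h rfl⟩
    · exact ⟨.inr (.aux (.inr ()) k), .rel _ _ (.inl rfl), fun h => h rfl⟩
  rintro (((i | j) | d | ⟨d, k⟩) | (i | d | ⟨d, k⟩)) h
  · obtain ⟨y, hy, hy'⟩ := key i
    exact ⟨y, .trans _ _ _ (.rel _ _ (.inr rfl)) hy, hy'⟩
  · exact absurd rfl h
  · exact absurd rfl h
  · exact absurd rfl h
  · exact key i
  · exact absurd rfl h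
  · exact absurd rfl h

end Plug

section Residue

variable {J : Type} [Finite J] {μ : Net J} {c c' : μ.Cell}

/-- The residue, plugged with an active pair. -/
noncomputable abbrev refill (hc : μ.wire (.prin c) = .prin c') : Net J :=
  (residue hc).plug (activePair (μ.kind c) (μ.kind c'))

theorem kind_residueCellMap (hc : μ.wire (.prin c) = .prin c') (d : (refill hc).Cell) :
    μ.kind (residueCellMap μ c c' d) = (refill hc).kind d := by
  rcases d with d | _ | _ <;> rfl

/-- From a port of the residue, the first unplugged port is the port of the refilled net that stands
for the same port of `μ`. -/
theorem hop_residue (hc : μ.wire (.prin c) = .prin c') (q : (residue hc).Ports) :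
    ∃ p : (refill hc).Ports, Hop (.inl q) (toFull (residue hc) (activePair _ _) p) ∧
      p.map (residueCellMap μ c c') (kind_residueCellMap hc) = residueEmb μ c c' q := by
  rcases q with ((k | k) | j) | d | ⟨d, k⟩
  · exact ⟨.aux (.inr (.inl ())) k, .step nofun (.refl fun h => h rfl), rfl⟩
  · exact ⟨.aux (.inr (.inr ())) k, .step nofun (.refl fun h => h rfl), rfl⟩
  · exact ⟨.free j, .refl fun h => h rfl, rfl⟩
  · exact ⟨.prin (.inl d), .refl fun h => h rfl, rfl⟩
  · exact ⟨.aux (.inl d) k, .refl fun h => h rfl, rfl⟩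

theorem refill_wire (hc : μ.wire (.prin c) = .prin c') (p : (refill hc).Ports) :
    μ.wire (p.map (residueCellMap μ c c') (kind_residueCellMap hc)) =
      ((refill hc).wire p).map (residueCellMap μ c c') (kind_residueCellMap hc) := by
  have key : ∀ q : (residue hc).Ports,
      p.map (residueCellMap μ c c') (kind_residueCellMap hc) = residueEmb μ c c' q →
      (∀ v, Hop (.inl ((residue hc).wire q)) v →
        Hop (across (residue hc) (activePair _ _) (toFull _ _ p)) v) →
      μ.wire (p.map (residueCellMap μ c c') (kind_residueCellMap hc)) =
        ((refill hc).wire p).map (residueCellMap μ c c') (kind_residueCellMap hc) := by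
    intro q hq hop
    obtain ⟨p', h, h'⟩ := hop_residue hc ((residue hc).wire q)
    rw [wire_plug_eq (hop _ h), h', hq, residueEmb_wire]
  let mp (q : (refill hc).Ports) := q.map (residueCellMap μ c c') (kind_residueCellMap hc)
  rcases p with j | (d | _ | _) | ⟨d | _ | _, k⟩
  · exact key (.free (.inr j)) rfl fun v h => h
  · exact key (.prin d) rfl fun v h => h
  · have : (refill hc).wire (.prin (.inr (.inl ()))) = .prin (.inr (.inr ())) :=
      wire_plug_eq (.refl fun h => h rfl)
    exact hc.trans (congrArg mp this.symm)
  · have : (refill hc).wire (.prin (.inr (.inr ()))) = .prin (.inr (.inl ())) :=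
      wire_plug_eq (.refl fun h => h rfl)
    refine Eq.trans ?_ (congrArg mp this.symm)
    change μ.wire (.prin c') = .prin c
    rw [← hc, wire_wire]
  · exact key (.aux d k) rfl fun v h => h
  · exact key (.free (.inl (.inl k))) rfl fun v h => .step nofun h
  · exact key (.free (.inl (.inr k))) rfl fun v h => .step nofun h

theorem exists_betaRule (α β : CellSymbol) : ∃ b, BetaRule (activePair α β) b := by
  classical
  by_cases h : α = β
  · subst h; exact ⟨_, .annihilation α⟩
  · exact ⟨_, .commutation α β h⟩

/-- A run with an inversion can be simplified by a step of `β`-reduction. -/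
theorem Run.exists_betaStep {m : μ.Cell → Bool} {i j : J} {x y l}
    (r : Run μ m (.free i) x l j y) (hl : 0 < inversions (l.map Prod.fst)) :
    ∃ (ν : Net J) (m' : ν.Cell → Bool) (l' : Itinerary), BetaStep μ ν ∧
      Run ν m' (.free i) x l' j y ∧
      inversions (l'.map Prod.fst) < inversions (l.map Prod.fst) := by
  obtain ⟨c, c', hc, H⟩ := r.exists_activePair hl
  obtain ⟨b, hb⟩ := exists_betaRule (μ.kind c) (μ.kind c')
  let e : (refill hc).Cell ≃ μ.Cell :=
    Equiv.ofBijective _ (residueCellMap_bijective (ne_of_wire_prin hc))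
  have h : ∀ d, μ.kind (e d) = (refill hc).kind d := kind_residueCellMap hc
  have h' : ∀ d, (refill hc).kind (e.symm d) = μ.kind d := fun d => by
    rw [← h, e.apply_symm_apply]
  have hloops : (refill hc).loops = μ.loops := by
    change μ.loops + 0 + newLoops _ _ = μ.loops
    rw [newLoops_activePair, add_zero, add_zero]
  have hα : AlphaEq (refill hc) μ := ⟨e, h, refill_wire hc, hloops⟩
  -- The cells of the active pair are marked, the other ones are not.
  let mk : (refill hc).Cell → Bool := Sum.elim (fun _ => false) (fun _ => true)
  have he : e.symm c = .inr (.inl ()) := e.symm_apply_eq.mpr rfl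
  obtain ⟨l', hl', r', hmark⟩ := H (mk ∘ e.symm) (by simp only [Function.comp, he]; rfl)
  have r'' := Run.map (e := e.symm) (h := h') (wire_map_symm e h h' (refill_wire hc)) r'
  obtain ⟨l'', r₁, -, lt⟩ := (run_plug_iff.mp r'').simplify
    (R' := fun i => Run b (fun _ => false) (.free i)) (fun _ _ _ _ _ r => hb.simplify r)
  refine ⟨(residue hc).plug b, _, l'', ⟨_, inferInstance, _, _, _, hb, hα.symm, .refl _⟩,
    run_plug_iff.mpr r₁, ?_⟩
  rw [← hl']
  exact lt hmark

end Residue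

/-- Every run becomes an observable axiom of some reduct. -/
theorem Run.exists_allObsPath {n : ℕ} {μ : Net (Fin n)} {m : μ.Cell → Bool} {i j : Fin n} {x y l}
    (r : Run μ m (.free i) x l j y) :
    ∃ a ∈ μ.AllObsPaths, s((x, i.val + 1), (y, j.val + 1)) ∈ vault a := by
  induction hN : inversions (l.map Prod.fst) using Nat.strong_induction_on generalizing μ l with
  | _ N ih =>
    subst hN
    rcases Nat.eq_zero_or_pos (inversions (l.map Prod.fst)) with h | h
    · obtain ⟨a, ha, h⟩ := r.exists_obsPath h
      exact ⟨a, ⟨μ, .refl, ha⟩, h⟩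
    · obtain ⟨ν, m', l', hν, r', lt⟩ := r.exists_betaStep h
      obtain ⟨a, ⟨ν', hν', ha⟩, h⟩ := ih _ lt r' rfl
      exact ⟨a, ⟨ν', .head (.inr hν) hν', ha⟩, h⟩

/-! ### The edifice is the input-output relation -/

theorem mem_edifice_iff {n : ℕ} {μ : Net (Fin n)} {a : Arch} : a ∈ μ.edifice ↔
    ∃ i x j y, μ.Exec i x j y ∧ a = s((x, i.val + 1), (y, j.val + 1)) := by
  simp only [edifice, Set.mem_iUnion, exists_prop]
  constructor
  · rintro ⟨x, ⟨μ', hμ, hx⟩, ha⟩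
    rw [hμ.exec_eq]
    exact exec_of_mem_vault hx ha
  · rintro ⟨i, x, j, y, ⟨l, r⟩, rfl⟩
    exact r.exists_allObsPath

theorem edifice_congr {n : ℕ} {μ ν : Net (Fin n)} (h : μ.Exec = ν.Exec) :
    μ.edifice = ν.edifice := by
  ext a
  rw [mem_edifice_iff, mem_edifice_iff, h]

theorem EpsRule.exec_eq ⦃I : Type⦄ (a b : Net I) (h : EpsRule a b) : a.Exec = b.Exec := by
  obtain ⟨μ, h, -⟩ := h
  ext i x j y
  refine iff_of_false (fun ⟨l, r⟩ => ?_) not_exec_epsNet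
  obtain ⟨a, ha, -⟩ := r.exists_allObsPath
  rw [Blind] at h
  rw [h] at ha
  exact ha

theorem BetaEpsRed.exec_eq {J : Type} [Finite J] {μ ν : Net J} (h : BetaEpsRed μ ν) :
    μ.Exec = ν.Exec := by
  induction h with
  | refl => rfl
  | tail _ h ih =>
    rcases h with h | h | h
    · exact ih.trans h.exec_eq
    · exact ih.trans (ContextClosure.exec_eq BetaRule.exec_eq h)
    · exact ih.trans (ContextClosure.exec_eq EpsRule.exec_eq h)

theorem EtaEq.exec_eq {J : Type} [Finite J] {μ ν : Net J} (h : EtaEq μ ν) : μ.Exec = ν.Exec := by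
  have key : ∀ {μ ν : Net J}, EtaZeroEq μ ν ∨ EtaOneEq μ ν → μ.Exec = ν.Exec := fun h =>
    h.elim (EquationalClosure.exec_eq EtaZeroRule.exec_eq)
      (EquationalClosure.exec_eq EtaOneRule.exec_eq)
  induction h with
  | single h => exact key h
  | tail _ h ih => exact ih.trans (key h)

theorem BetaEpsEtaEq.exec_eq {J : Type} [Finite J] {μ ν : Net J} (h : BetaEpsEtaEq μ ν) :
    μ.Exec = ν.Exec := by
  have key : ∀ {μ ν : Net J}, BetaEpsEq μ ν ∨ EtaEq μ ν → μ.Exec = ν.Exec := by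
    rintro μ ν (⟨o, h, h'⟩ | h)
    · exact h.exec_eq.trans h'.exec_eq.symm
    · exact h.exec_eq
  induction h with
  | single h => exact key h
  | tail _ h ih => exact ih.trans (key h)

end Net

end SymComb

theorem mainTheorem4 {n : ℕ} (μ ν : SymComb.Net (Fin n)) :
    (SymComb.Net.BetaEpsEtaEq μ ν → μ.edifice = ν.edifice) ∧
    (SymComb.Net.BetaRed μ ν → μ.edifice = ν.edifice) ∧
    (SymComb.Net.EpsStep μ ν → μ.edifice = ν.edifice) ∧
    (SymComb.Net.EtaZeroEq μ ν → μ.edifice = ν.edifice) ∧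
    (SymComb.Net.EtaOneEq μ ν → μ.edifice = ν.edifice) :=
  open SymComb.Net in
  ⟨fun h => edifice_congr h.exec_eq, fun h => edifice_congr h.exec_eq,
    fun h => edifice_congr (ContextClosure.exec_eq EpsRule.exec_eq h),
    fun h => edifice_congr (EquationalClosure.exec_eq EtaZeroRule.exec_eq h),
    fun h => edifice_congr (EquationalClosure.exec_eq EtaOneRule.exec_eq h)⟩
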